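/- **Model.** Let $\mathcal A$ be a finite set of arms and $\overline\Omega\subset\mathbb R$ a finite set of outcomes, and let $X_i(\omega)=\omega_i$ on $\Omega=\overline\Omega^{\mathbb N}$, $i\ge 1$. A strategy is a sequence $s=(s_i)_{i\ge1}$ of functions $s_i:\mathcal A^{i-1}\times\overline\Omega^{\,i-1}\to\mathcal A$ that choose the arm $a_i=s_i(a_1,\dots,a_{i-1},\omega_1,\dots,\omega_{i-1})$ at stage $i$ from past arms and outcomes; $\mathcal S$ is the set of strategies. Beliefs are given by conditional probability laws $P_i^{s_i}(\cdot\mid a^{(i-1)},\omega^{(i-1)})$ on $\overline\Omega$, for every $i$, $s_i$ and history. Each is assumed to have full support on $\overline\Omega$ and mean $0$. For $s\in\mathcal S$, $P^s$ denotes the probability measure on $\Omega$ with these one-step-ahead conditionals along the action histories generated by $s$ (Ionescu-Tulcea). Assume that there is no learning: $P_i^{s_i}(\cdot\mid a^{(i-1)},\omega^{(i-1)})=P_1^{a}$ whenever $s_i(a^{(i-1)},\omega^{(i-1)})=a$, where $P_1^a$ is the law of the first outcome if arm $a$ is chosen at stage 1. Let $\sigma_a^2=\int x^2\,dP_1^a$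 (with $\sigma_a\ge 0$), $\overline\sigma=\max_{a}\sigma_a$, $\underline\sigma=\min_a\sigma_a$, assume $\overline\sigma>\underline\sigma>0$, and let $\overline a,\underline a$ be arms with $\sigma_{\overline a}=\overline\sigma$ and $\sigma_{\underline a}=\underline\sigma$. **Utility.** Let $\theta=\underline\sigma/\overline\sigma$ and let $\varphi_1:[0,\infty)\to\mathbb R$ be $C^3$ with bounded third derivative, $\varphi_1(0)=0$, strictly increasing and strictly concave on $(0,\infty)$. With reference point $c=0$, put $\varphi(x)=\varphi_1(x)$ for $x\ge0$ and $\varphi(x)=-\theta^{-1}\varphi_1(-\theta x)$ for $x<0$. Let $U_n(s)=E_{P^s}\big[\varphi\big(\sum_{i=1}^nX_i/\sqrt n\big)\big]$ and $V_n=\sup_{s\in\mathcal S}U_n(s)$. A strategy $s$ is asymptotically optimal if $\lim_n V_n$ exists and $\lim_n U_n(s)=\lim_n V_n$. **Theorem.** Let $s^*$ be the strategy with $s_1^*=\overline a$ and, for $n>1$, $s_n^*=\overline a$ if $\sum_{i=1}^{n-1}X_i\le0$ and $s_n^*=\underline a$ if $\sum_{i=1}^{n-1}X_i>0$. Then: (i)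 $s^*$ is asymptotically optimal. (ii) For every integer $N>0$, $$P^{s^*}\Big(\bigcap_{n=N}^\infty\Big\{\sum_{i=1}^nX_i\le0\Big\}\Big)\le\frac{\overline\sigma}{\overline\sigma+\underline\sigma}<1\quad\text{and}\quad P^{s^*}\Big(\bigcap_{n=N}^\infty\Big\{\sum_{i=1}^nX_i>0\Big\}\Big)\le\frac{\overline\sigma}{\overline\sigma+\underline\sigma}<1.$$ (iii) The high-variance action is chosen less frequently in the limit: $$\lim_{n\to\infty}\frac{P^{s^*}(\sigma_{s_n^*}=\overline\sigma)}{P^{s^*}(\sigma_{s_n^*}=\underline\sigma)}=\frac{\underline\sigma}{\overline\sigma}<1.$$ -/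

import Mathlib

open MeasureTheory ProbabilityTheory Filter Topology

namespace Bandit

noncomputable section

/-! Stages are indexed from `0`: stage `i` here is the `(i+1)`-st pull. `A` is the set of arms and
the finite set `Ω ⊆ ℝ` is the common set of possible outcomes of every pull. -/

/-- A strategy at stage `i`: a choice of arm as a function of the `i` past actions and the `i`
past outcomes. -/
abbrev StageStrategy (A : Type*) (Ω : Finset ℝ) (i : ℕ) : Type _ :=
  (Fin i → A) → (Fin i → Ω) → A

/-- A strategy is a sequence of stage strategies. -/
abbrev Strategy (A : Type*) (Ω : Finset ℝ) : Type _ :=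
  ∀ i : ℕ, StageStrategy A Ω i

/-- Beliefs: the primitive one-step-ahead conditionals. `law i sᵢ a ω` is the law of the outcome at
stage `i` if the stage strategy `sᵢ` is used after the action history `a` and the outcome
history `ω`. -/
structure Beliefs (A : Type*) (Ω : Finset ℝ) where
  /-- The one-step-ahead conditional law. -/
  law : ∀ i : ℕ, StageStrategy A Ω i → (Fin i → A) → (Fin i → Ω) → Measure Ω
  /-- Every one-step-ahead conditional is a probability measure. -/
  isProbabilityMeasure : ∀ i sᵢ a ω, IsProbabilityMeasure (law i sᵢ a ω)

section Strategies

variable {A : Type*} {Ω : Finset ℝ}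

/-- The action history that a strategy generates along an outcome history. -/
def actionHistory (s : Strategy A Ω) : ∀ i : ℕ, (Fin i → Ω) → (Fin i → A)
  | 0, _ => Fin.elim0
  | i + 1, ω =>
    Fin.snoc (α := fun _ => A) (actionHistory s i (Fin.init ω))
      (s i (actionHistory s i (Fin.init ω)) (Fin.init ω))

/-- The first `i` outcomes of an outcome sequence. -/
def outcomeHistory (i : ℕ) (ω : ℕ → Ω) : Fin i → Ω := fun j => ω j

/-- The action that the strategy `s` takes at stage `i` along the outcome sequence `ω`. -/
def action (s : Strategy A Ω) (i : ℕ) (ω : ℕ → Ω) : A :=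
  s i (actionHistory s i (outcomeHistory i ω)) (outcomeHistory i ω)

/-- The sum of the first `n` outcomes: the cumulative gains after `n` pulls. -/
def gains (n : ℕ) (ω : ℕ → Ω) : ℝ := ∑ i ∈ Finset.range n, (ω i : ℝ)

/-- Play `aHi` if the cumulative gains so far are nonpositive (in particular at the first stage,
where they are the empty sum), and `aLo` if they are positive. -/
def switchingStrategy (aHi aLo : A) : Strategy A Ω :=
  fun _ _ ω => if ∑ j, (ω j : ℝ) ≤ 0 then aHi else aLo

end Strategies

namespace Beliefs

variable {A : Type*} {Ω : Finset ℝ}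

/-- Every one-step-ahead conditional charges every possible outcome. -/
def FullSupport (B : Beliefs A Ω) : Prop :=
  ∀ i sᵢ a ω, ∀ x : Ω, 0 < B.law i sᵢ a ω {x}

/-- Every one-step-ahead conditional has mean zero. -/
def MeanZero (B : Beliefs A Ω) : Prop :=
  ∀ i sᵢ a ω, ∫ x, (x : ℝ) ∂(B.law i sᵢ a ω) = 0

/-- The prior law of the outcome of arm `a`: the belief at the first stage if `a` is chosen. -/
def priorLaw (B : Beliefs A Ω) (a : A) : Measure Ω :=
  B.law 0 (fun _ _ => a) Fin.elim0 Fin.elim0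

/-- There is no learning: at every stage and every history, the conditional law of the outcome is
the prior law of the arm that is chosen there. -/
def NoLearning (B : Beliefs A Ω) : Prop :=
  ∀ i sᵢ a ω, B.law i sᵢ a ω = B.priorLaw (sᵢ a ω)

/-- The standard deviation `σ_a` of arm `a` (outcomes have mean zero). -/
def sd (B : Beliefs A Ω) (a : A) : ℝ :=
  Real.sqrt (∫ x, (x : ℝ) ^ 2 ∂(B.priorLaw a))

/-- The one-step-ahead conditional at stage `i` under the strategy `s`, as a function of the
outcome history alone: the action history is the one that `s` generates. -/
def stepLaw (B : Beliefs A Ω) (s : Strategy A Ω) (i : ℕ) (ω : Fin i → Ω) : Measure Ω :=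
  B.law i (s i) (actionHistory s i ω) ω

/-- `stepLaw` at stage `n + 1` as a kernel. -/
def stepKernel (B : Beliefs A Ω) (s : Strategy A Ω) (n : ℕ) :
    Kernel (∀ _ : Finset.Iic n, Ω) Ω where
  toFun ω := B.stepLaw s (n + 1)
    fun j => ω ⟨j, Finset.mem_Iic.2 (Nat.lt_succ_iff.1 j.isLt)⟩
  measurable' := measurable_of_countable _

instance (B : Beliefs A Ω) (s : Strategy A Ω) (i : ℕ) (ω : Fin i → Ω) :
    IsProbabilityMeasure (B.stepLaw s i ω) :=
  B.isProbabilityMeasure _ _ _ _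

instance (B : Beliefs A Ω) (s : Strategy A Ω) (n : ℕ) : IsMarkovKernel (B.stepKernel s n) :=
  ⟨fun _ => B.isProbabilityMeasure _ _ _ _⟩

/-- The measure `P^s` on outcome sequences: the Ionescu-Tulcea extension of the one-step-ahead
conditionals under the strategy `s`. -/
def pathMeasure (B : Beliefs A Ω) (s : Strategy A Ω) : Measure (ℕ → Ω) :=
  Kernel.trajMeasure (X := fun _ => Ω) (B.stepLaw s 0 Fin.elim0) (B.stepKernel s)

/-- The expected utility `U_n(s)` of the strategy `s` at horizon `n`, for the utility
index `φ`. -/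
def utility (B : Beliefs A Ω) (φ : ℝ → ℝ) (n : ℕ) (s : Strategy A Ω) : ℝ :=
  ∫ ω, φ (gains n ω / Real.sqrt n) ∂(B.pathMeasure s)

/-- The value `V_n` of the problem with horizon `n`. -/
def value (B : Beliefs A Ω) (φ : ℝ → ℝ) (n : ℕ) : ℝ :=
  ⨆ s : Strategy A Ω, B.utility φ n s

instance (B : Beliefs A Ω) (s : Strategy A Ω) : IsProbabilityMeasure (B.pathMeasure s) := by
  unfold pathMeasure; infer_instance

/-- The supremum that defines `value` is over a set that is bounded above. -/
theorem bddAbove_utility (B : Beliefs A Ω) (φ : ℝ → ℝ) (n : ℕ) :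
    BddAbove (Set.range fun s : Strategy A Ω => B.utility φ n s) := by
  have hfin : (Set.range fun ω : ℕ → Ω => φ (gains n ω / Real.sqrt n)).Finite := by
    refine (Set.finite_range fun h : Fin n → Ω => φ ((∑ j, (h j : ℝ)) / Real.sqrt n)).subset ?_
    rintro _ ⟨ω, rfl⟩
    exact ⟨outcomeHistory n ω, by simp [gains, outcomeHistory, Finset.sum_range]⟩
  obtain ⟨C, hC⟩ := (hfin.image fun x => ‖x‖).bddAbove
  refine ⟨C, ?_⟩
  rintro _ ⟨s, rfl⟩
  have h := norm_integral_le_of_norm_le_const (μ := B.pathMeasure s)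
    (f := fun ω => φ (gains n ω / Real.sqrt n)) (C := C)
    (Eventually.of_forall fun ω => hC ⟨_, ⟨ω, rfl⟩, rfl⟩)
  rw [probReal_univ, mul_one] at h
  exact (le_abs_self _).trans h

/-- `s` is asymptotically optimal: the limit of the values `V_n` exists and equals the limit of the
expected utilities `U_n(s)`. -/
def IsAsymptoticallyOptimal (B : Beliefs A Ω) (φ : ℝ → ℝ) (s : Strategy A Ω) : Prop :=
  ∃ V : ℝ, Tendsto (fun n => B.value φ n) atTop (𝓝 V) ∧
    Tendsto (fun n => B.utility φ n s) atTop (𝓝 V)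

end Beliefs

/-- The loss averse utility index with reference point `c`, built from the utility of gains `φ₁`
and the parameter `θ`. -/
def utilityIndex (φ₁ : ℝ → ℝ) (θ c : ℝ) (x : ℝ) : ℝ :=
  if c ≤ x then φ₁ (x - c) else -(θ⁻¹ * φ₁ (-θ * (x - c)))

/-- The assumptions on the utility of gains: `φ₁` vanishes at `0`, is three times continuously
differentiable on `[0, ∞)` (one-sidedly at `0`) with bounded third derivative, and is strictly
increasing and strictly concave on `(0, ∞)`. -/
structure IsGainUtility (φ₁ : ℝ → ℝ) : Prop where
  zero : φ₁ 0 = 0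
  contDiffOn : ContDiffOn ℝ 3 φ₁ (Set.Ici 0)
  bounded : ∃ K : ℝ, ∀ x ∈ Set.Ici (0 : ℝ), |iteratedDerivWithin 3 φ₁ (Set.Ici 0) x| ≤ K
  strictMonoOn : StrictMonoOn φ₁ (Set.Ioi 0)
  strictConcaveOn : StrictConcaveOn ℝ (Set.Ioi 0) φ₁

end

end Bandit

/-!
Write `θ = σlo / σhi`. The proof never constructs the limiting diffusion (a Brownian motion that
oscillates between the standard deviation `σhi` on losses and `σlo` on gains). It uses one family of
test functions, on which the Hamilton-Jacobi-Bellman equation is explicit: for an odd function `h`,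
let `twoScale θ h` be `h x` for `0 ≤ x` and `θ⁻¹ * h (θ * x)` for `x < 0`. The utility index with
reference point `0` is of this form, with `h` the odd extension of the utility of gains. Oddness
makes `twoScale θ h` of class `C²` with Lipschitz second derivative when `h` is, because
`h 0 = h'' 0 = 0`. If `h` evolves by the heat equation of variance `σlo ^ 2`, then `twoScale θ h`
evolves by the heat equation whose variance is `σlo ^ 2` on gains and `σhi ^ 2` on losses, and stays
`0` at `0`. The heat flow is replaced by a random walk with uniform increments (`windowAverage`),
which has the same expansion to second order and keeps all regularity bounds.

* The switching strategy follows exactly this evolution, so a Lindeberg replacement argument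
  (`Beliefs.integral_gains_le`) shows that the expectation of every `twoScale θ h` at the normalized
  gains tends to `0` (`Beliefs.tendsto_integral_twoScale_gains`).
* If `h` is concave on gains, it remains so along the walk, and `twoScale θ h` is concave on gains
  and convex on losses. No strategy then beats this evolution by more than the replacement error, so
  the values have a nonpositive upper limit (`Beliefs.eventually_integral_twoScale_gains_le`).
  Together, both limits in the first claim are `0`.
* For `h` the sign function, `twoScale θ h` is a multiple of the indicator of gains minus the
  constant `σhi / (σhi + σlo)`. Hence this constant is the limit of the probability of gains
  (`Beliefs.tendsto_measureReal_gains_pos`), once the jump at `0` is smoothed. That is harmless since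
  small normalized gains are unlikely (`Beliefs.exists_eventually_measureReal_abs_gains_le`), which a
  Gaussian supersolution shows for all strategies at once.

The second claim follows as staying in losses (gains) from stage `N` on is less likely than being in
losses (gains) at any single later stage, and the third since the switching strategy uses the two
variances exactly on gains and on losses.
-/

namespace Bandit

/-! ### Integration against the law of the outcome path -/

namespace Beliefs

variable {A : Type*} {Ω : Finset ℝ}

/-- The first outcome has the law prescribed by the strategy at the empty history. -/
theorem map_eval_zero_pathMeasure (B : Beliefs A Ω) (s : Strategy A Ω) :
    (B.pathMeasure s).map (fun ω => ω 0) = B.stepLaw s 0 Fin.elim0 := by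
  have h0 : Measurable (fun ω : ℕ → Ω => ω 0) := measurable_pi_apply 0
  have h1 : Measurable (fun x : (∀ _ : Finset.Iic 0, Ω) => x ⟨0, by simp⟩) :=
    measurable_pi_apply _
  have hcomp : (fun ω : ℕ → Ω => ω 0) =
      (fun x : (∀ _ : Finset.Iic 0, Ω) => x ⟨0, by simp⟩) ∘ Preorder.frestrictLe 0 := rfl
  rw [hcomp, ← Measure.map_map h1 (by fun_prop), pathMeasure, Kernel.trajMeasure,
    Measure.map_comp _ _ (by fun_prop), Kernel.traj_map_frestrictLe, Kernel.partialTraj_self,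
    Measure.id_comp, Measure.map_map h1 (by fun_prop)]
  exact Measure.map_id

/-- A function of finitely many outcomes is integrable. -/
theorem integrable_of_outcomeHistory (B : Beliefs A Ω) (s : Strategy A Ω) {n : ℕ}
    (F : (Fin n → Ω) → ℝ) : Integrable (fun ω => F (outcomeHistory n ω)) (B.pathMeasure s) := by
  have hm : Measurable (outcomeHistory (Ω := Ω) n) :=
    measurable_pi_lambda _ fun j => measurable_pi_apply _
  have : Integrable F ((B.pathMeasure s).map (outcomeHistory n)) := by
    have := Measure.isProbabilityMeasure_map (μ := B.pathMeasure s) hm.aemeasurable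
    exact Integrable.of_finite
  exact this.comp_measurable hm

/-- Integration of a function of the first `n + 1` outcomes, one step ahead: the last outcome is
integrated first, against its conditional law. -/
theorem integral_pathMeasure_succ (B : Beliefs A Ω) (s : Strategy A Ω) (n : ℕ)
    (F : (Fin n → Ω) → Ω → ℝ) :
    ∫ ω, F (outcomeHistory n ω) (ω n) ∂(B.pathMeasure s) =
      ∫ ω, (∫ x, F (outcomeHistory n ω) x ∂(B.stepLaw s n (outcomeHistory n ω)))
        ∂(B.pathMeasure s) := by
  cases n with
  | zero =>
    have hsub : ∀ ω : ℕ → Ω, outcomeHistory 0 ω = Fin.elim0 := fun ω => Subsingleton.elim _ _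
    simp only [hsub, integral_const, probReal_univ, one_smul]
    rw [← map_eval_zero_pathMeasure, integral_map (measurable_pi_apply 0).aemeasurable
      (measurable_of_countable _).aestronglyMeasurable]
  | succ n =>
    let e : (∀ _ : Finset.Iic n, Ω) → (Fin (n + 1) → Ω) := fun ω j =>
      ω ⟨j, Finset.mem_Iic.2 (Nat.lt_succ_iff.1 j.isLt)⟩
    have key := Kernel.map_frestrictLe_trajMeasure_compProd_eq_map_trajMeasure
      (X := fun _ => Ω) (μ₀ := B.stepLaw s 0 Fin.elim0) (κ := B.stepKernel s) (a := n)
    have hr : Measurable (Preorder.frestrictLe (π := fun _ : ℕ => (Ω : Type)) n) := by fun_prop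
    have hp : Measurable (fun ω : ℕ → Ω =>
        (Preorder.frestrictLe (π := fun _ : ℕ => (Ω : Type)) n ω, ω (n + 1))) := by fun_prop
    change (B.pathMeasure s).map _ ⊗ₘ _ = (B.pathMeasure s).map _ at key
    have hprob := Measure.isProbabilityMeasure_map (μ := B.pathMeasure s) hr.aemeasurable
    have h1 := integral_map (μ := B.pathMeasure s) hp.aemeasurable
      (f := fun p : (∀ _ : Finset.Iic n, Ω) × Ω => F (e p.1) p.2)
      (measurable_of_countable _).aestronglyMeasurable
    rw [← key, Measure.integral_compProd Integrable.of_finite,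
      integral_map hr.aemeasurable (measurable_of_countable _).aestronglyMeasurable] at h1
    exact h1.symm

theorem gains_eq_sum_outcomeHistory (n : ℕ) (ω : ℕ → Ω) :
    gains n ω = ∑ j, (outcomeHistory n ω j : ℝ) := by
  simp [gains, outcomeHistory, Finset.sum_range]

theorem integrable_comp_gains (B : Beliefs A Ω) (s : Strategy A Ω) (n : ℕ) (f : ℝ → ℝ) :
    Integrable (fun ω => f (gains n ω)) (B.pathMeasure s) := by
  simpa only [gains_eq_sum_outcomeHistory] using
    B.integrable_of_outcomeHistory s (fun h : Fin n → Ω => f (∑ j, (h j : ℝ)))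

/-- Without learning, the expectation of a function of the cumulative gains is computed one step
ahead with the prior law of the arm that is pulled. -/
theorem integral_gains_succ (B : Beliefs A Ω) (hnl : B.NoLearning) (s : Strategy A Ω) (n : ℕ)
    (f : ℝ → ℝ) :
    ∫ ω, f (gains (n + 1) ω) ∂(B.pathMeasure s) =
      ∫ ω, (∫ x, f (gains n ω + (x : ℝ)) ∂(B.priorLaw (action s n ω))) ∂(B.pathMeasure s) := by
  have h := B.integral_pathMeasure_succ s n
    (fun h x => f (∑ j, (h j : ℝ) + (x : ℝ)))
  simp only [← gains_eq_sum_outcomeHistory] at h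
  simp only [gains, Finset.sum_range_succ] at h ⊢
  rw [h]
  refine integral_congr_ae (Eventually.of_forall fun ω => ?_)
  simp only [stepLaw, hnl n, action]

/-- The discrete maximum principle. If `u 0, …, u n` are such that one pull, as seen from every
reachable state, maps `u k` below `u (k + 1)` up to an error `ε`, then the expectation of `u 0` at
the terminal gains is at most `u n 0 + n * ε`. -/
theorem integral_gains_le (B : Beliefs A Ω) (hnl : B.NoLearning) (s : Strategy A Ω) (n : ℕ)
    (u : ℕ → ℝ → ℝ) (ε : ℝ)
    (hu : ∀ k i, ∀ ω : ℕ → Ω, k + i + 1 = n →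
      ∫ x, u k (gains i ω + (x : ℝ)) ∂(B.priorLaw (action s i ω)) ≤ u (k + 1) (gains i ω) + ε) :
    ∫ ω, u 0 (gains n ω) ∂(B.pathMeasure s) ≤ u n 0 + n * ε := by
  have main : ∀ k, k ≤ n → ∫ ω, u 0 (gains n ω) ∂(B.pathMeasure s) ≤
      ∫ ω, u k (gains (n - k) ω) ∂(B.pathMeasure s) + k * ε := by
    intro k
    induction k with
    | zero => simp
    | succ k ih =>
      intro hk
      refine (ih (by omega)).trans ?_
      obtain ⟨i, hi⟩ : ∃ i, k + i + 1 = n := ⟨n - (k + 1), by omega⟩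
      have h1 : n - k = i + 1 := by omega
      have h2 : n - (k + 1) = i := by omega
      rw [h1, h2, B.integral_gains_succ hnl]
      have h3 : ∫ ω, (∫ x, u k (gains i ω + (x : ℝ)) ∂(B.priorLaw (action s i ω)))
          ∂(B.pathMeasure s) ≤ ∫ ω, (u (k + 1) (gains i ω) + ε) ∂(B.pathMeasure s) := by
        refine integral_mono ?_ ((B.integrable_comp_gains s i _).add (integrable_const _))
          fun ω => hu k i ω hi
        simpa only [gains_eq_sum_outcomeHistory, action] using
          B.integrable_of_outcomeHistory s (fun h : Fin i → Ω =>
            ∫ x, u k (∑ j, (h j : ℝ) + (x : ℝ)) ∂(B.priorLaw (s i (actionHistory s i h) h)))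
      rw [integral_add (B.integrable_comp_gains s i _) (integrable_const _)] at h3
      simp only [integral_const, probReal_univ, one_smul] at h3
      push_cast
      linarith
  simpa [gains] using main n le_rfl

end Beliefs

/-! ### Second-order Taylor expansions -/

/-- Taylor's formula of order two, for a function whose second derivative is `M`-Lipschitz. -/
theorem abs_taylor_two_le {M : ℝ} {u u' u'' : ℝ → ℝ} (h1 : ∀ x, HasDerivAt u (u' x) x)
    (h2 : ∀ x, HasDerivAt u' (u'' x) x) (hM : ∀ x y, |u'' x - u'' y| ≤ M * |x - y|) (x y : ℝ) :
    |u (x + y) - (u x + u' x * y + u'' x / 2 * y ^ 2)| ≤ M * |y| ^ 3 := by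
  have hM0 : 0 ≤ M := by simpa using (abs_nonneg _).trans (hM 1 0)
  let s : Set ℝ := Metric.closedBall 0 |y|
  have hs : Convex ℝ s := convex_closedBall _ _
  have h0s : (0 : ℝ) ∈ s := by simp [s]
  have hsub : ∀ t ∈ s, |t| ≤ |y| := fun t ht => by simpa [s] using ht
  have hys : y ∈ s := by simp [s]
  have hadd : ∀ t, HasDerivAt (fun t => x + t) 1 t := fun t => (hasDerivAt_id t).const_add x
  have B1 : ∀ t ∈ s, |u' (x + t) - (u' x + u'' x * t)| ≤ M * |y| ^ 2 := by
    intro t ht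
    have hd : ∀ z ∈ s, HasDerivWithinAt (fun z => u' (x + z) - (u' x + u'' x * z))
        (u'' (x + z) - u'' x) s z := by
      intro z _
      have e1 := (h2 (x + z)).comp z (hadd z)
      have e2 := ((hasDerivAt_id z).const_mul (u'' x)).const_add (u' x)
      exact ((e1.sub e2).congr_deriv (by simp)).hasDerivWithinAt
    have hb : ∀ z ∈ s, ‖u'' (x + z) - u'' x‖ ≤ M * |y| := by
      intro z hz
      have e := hM (x + z) x
      rw [add_sub_cancel_left] at e
      exact e.trans (mul_le_mul_of_nonneg_left (hsub z hz) hM0)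
    have e := hs.norm_image_sub_le_of_norm_hasDerivWithin_le hd hb h0s ht
    simp only [add_zero, mul_zero, sub_self, sub_zero, Real.norm_eq_abs] at e
    refine e.trans ?_
    rw [pow_two, ← mul_assoc]
    exact mul_le_mul_of_nonneg_left (hsub t ht) (by positivity)
  have hd : ∀ z ∈ s, HasDerivWithinAt (fun z => u (x + z) - (u x + u' x * z + u'' x / 2 * z ^ 2))
      (u' (x + z) - (u' x + u'' x * z)) s z := by
    intro z _
    have e1 := (h1 (x + z)).comp z (hadd z)
    have e2 := ((hasDerivAt_id z).const_mul (u' x)).const_add (u x)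
    have e3 := ((hasDerivAt_id z).pow 2).const_mul (u'' x / 2)
    have e4 := (e1.sub (e2.add e3)).hasDerivWithinAt (s := s)
    refine (e4.congr_deriv ?_)
    simp
    ring
  have e := hs.norm_image_sub_le_of_norm_hasDerivWithin_le hd B1 h0s hys
  simp only [add_zero, mul_zero, sub_zero, Real.norm_eq_abs, ne_eq, OfNat.ofNat_ne_zero,
    not_false_eq_true, zero_pow, sub_self] at e
  exact e.trans_eq (by ring)

/-- One pull of an arm with mean zero changes the expectation of a smooth function by half the
variance times the second derivative, up to the cube of the step size `q`. -/
theorem abs_integral_taylor_two_le {Ω : Finset ℝ} {μ : Measure Ω} [IsProbabilityMeasure μ]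
    (hμ : ∫ x, (x : ℝ) ∂μ = 0) {R : ℝ} (hR : ∀ x : Ω, |(x : ℝ)| ≤ R) {q : ℝ} (hq : 0 ≤ q)
    {M : ℝ} {u u' u'' : ℝ → ℝ} (h1 : ∀ x, HasDerivAt u (u' x) x)
    (h2 : ∀ x, HasDerivAt u' (u'' x) x) (hM : ∀ x y, |u'' x - u'' y| ≤ M * |x - y|) (y : ℝ) :
    |∫ x : Ω, u (y + q * x) ∂μ - (u y + q ^ 2 / 2 * (∫ x, (x : ℝ) ^ 2 ∂μ) * u'' y)| ≤
      M * (q * R) ^ 3 := by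
  have hM0 : 0 ≤ M := by simpa using (abs_nonneg _).trans (hM 1 0)
  have hint : ∀ f : Ω → ℝ, Integrable f μ := fun f => Integrable.of_finite
  have e : ∫ x : Ω, (u y + u' y * (q * x) + u'' y / 2 * (q * x) ^ 2) ∂μ =
      u y + q ^ 2 / 2 * (∫ x, (x : ℝ) ^ 2 ∂μ) * u'' y := by
    rw [integral_add (hint _) (hint _), integral_add (hint _) (hint _)]
    simp only [mul_pow, integral_const_mul, hμ, integral_const, probReal_univ, one_smul]
    ring
  rw [← e, ← integral_sub (hint _) (hint _)]
  have hb : ∀ x : Ω, ‖u (y + q * x) - (u y + u' y * (q * x) + u'' y / 2 * (q * x) ^ 2)‖ ≤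
      M * (q * R) ^ 3 := by
    intro x
    refine (abs_taylor_two_le h1 h2 hM y (q * x)).trans ?_
    have : |q * (x : ℝ)| ≤ q * R := by
      rw [abs_mul, abs_of_nonneg hq]
      exact mul_le_mul_of_nonneg_left (hR x) hq
    gcongr
  simpa using norm_integral_le_of_norm_le_const (μ := μ) (Eventually.of_forall hb)

/-! ### Averages over a window -/

/-- The average of `f` over the window `[x - r, x + r]`: one step of a random walk with uniformly
distributed increments. The uniform law is used because it is unimodal, so that averaging preserves
concavity on the half-line of odd functions. -/
noncomputable def windowAverage (r : ℝ) (f : ℝ → ℝ) (x : ℝ) : ℝ :=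
  (∫ y in (x - r)..(x + r), f y) / (2 * r)

theorem windowAverage_eq (r : ℝ) (f : ℝ → ℝ) (x : ℝ) :
    windowAverage r f x = (∫ t in (-r)..r, f (x + t)) / (2 * r) := by
  rw [windowAverage, intervalIntegral.integral_comp_add_left]
  simp [sub_eq_add_neg]

theorem abs_windowAverage_sub_le {r : ℝ} (hr : 0 < r) {f p : ℝ → ℝ} (hf : Continuous f)
    (hp : Continuous p) {x C : ℝ} (h : ∀ t, |t| ≤ r → |f (x + t) - p t| ≤ C) :
    |windowAverage r f x - (∫ t in (-r)..r, p t) / (2 * r)| ≤ C := by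
  have hfx : Continuous fun t => f (x + t) := by fun_prop
  rw [windowAverage_eq, ← sub_div, ← intervalIntegral.integral_sub
    (hfx.intervalIntegrable _ _) (hp.intervalIntegrable _ _), abs_div,
    abs_of_pos (by positivity : 0 < 2 * r), div_le_iff₀ (by positivity)]
  have := intervalIntegral.norm_integral_le_of_norm_le_const (a := -r) (b := r) (C := C)
    (f := fun t => f (x + t) - p t) (by
      intro t ht
      rw [Set.uIoc_of_le (by linarith)] at ht
      exact h t (abs_le.2 ⟨ht.1.le, ht.2⟩))
  rw [Real.norm_eq_abs, show r - -r = 2 * r by ring, abs_of_pos (by positivity : 0 < 2 * r)] at this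
  exact this

theorem hasDerivAt_windowAverage {r : ℝ} {f : ℝ → ℝ} (hf : Continuous f) (x : ℝ) :
    HasDerivAt (windowAverage r f) ((f (x + r) - f (x - r)) / (2 * r)) x := by
  have hF : ∀ z, HasDerivAt (fun z => ∫ y in (0 : ℝ)..z, f y) (f z) z := fun z =>
    intervalIntegral.integral_hasDerivAt_right (hf.intervalIntegrable _ _)
      hf.stronglyMeasurable.stronglyMeasurableAtFilter hf.continuousAt
  have e : windowAverage r f = fun x =>
      ((∫ y in (0 : ℝ)..(x + r), f y) - ∫ y in (0 : ℝ)..(x - r), f y) / (2 * r) := by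
    funext x
    rw [windowAverage, intervalIntegral.integral_interval_sub_left (hf.intervalIntegrable _ _)
      (hf.intervalIntegrable _ _)]
  rw [e]
  have h1 := (hF (x + r)).comp x ((hasDerivAt_id x).add_const r)
  have h2 := (hF (x - r)).comp x ((hasDerivAt_id x).sub_const r)
  simpa [Function.comp_def] using (h1.sub h2).div_const (2 * r)

theorem hasDerivAt_windowAverage_of_hasDerivAt {r : ℝ} {f f' : ℝ → ℝ}
    (hf : ∀ x, HasDerivAt f (f' x) x) (hf' : Continuous f') (x : ℝ) :
    HasDerivAt (windowAverage r f) (windowAverage r f' x) x := by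
  have hc : Continuous f := continuous_iff_continuousAt.2 fun x => (hf x).continuousAt
  have := hasDerivAt_windowAverage (r := r) hc x
  rwa [← intervalIntegral.integral_eq_sub_of_hasDerivAt (fun y _ => hf y)
    (hf'.intervalIntegrable _ _)] at this

theorem windowAverage_neg {r : ℝ} {f : ℝ → ℝ} (hf : ∀ x, f (-x) = -f x) (x : ℝ) :
    windowAverage r f (-x) = -windowAverage r f x := by
  have h := intervalIntegral.integral_comp_neg (a := x - r) (b := x + r) f
  simp only [hf, intervalIntegral.integral_neg] at h
  rw [windowAverage, windowAverage, show -x - r = -(x + r) by ring,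
    show -x + r = -(x - r) by ring, ← h, neg_div]

theorem abs_windowAverage_sub_windowAverage_le {r M : ℝ} (hr : 0 < r) {f : ℝ → ℝ}
    (hf : Continuous f) (hM : ∀ x y, |f x - f y| ≤ M * |x - y|) (x y : ℝ) :
    |windowAverage r f x - windowAverage r f y| ≤ M * |x - y| := by
  rw [windowAverage_eq r f y]
  refine abs_windowAverage_sub_le hr hf (by fun_prop) fun t _ => ?_
  simpa using hM (x + t) (y + t)

theorem abs_windowAverage_sub_self_le {r M : ℝ} (hr : 0 < r) {f : ℝ → ℝ}
    (hf : Continuous f) (hM : ∀ x y, |f x - f y| ≤ M * |x - y|) (x : ℝ) :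
    |windowAverage r f x - f x| ≤ M * r := by
  have hM0 : 0 ≤ M := by simpa using (abs_nonneg _).trans (hM 1 0)
  have h := abs_windowAverage_sub_le hr hf (continuous_const (y := f x)) (x := x) (C := M * r)
    fun t ht => (hM (x + t) x).trans (by simpa using mul_le_mul_of_nonneg_left ht hM0)
  have e : (∫ _ in (-r)..r, f x) / (2 * r) = f x := by
    rw [intervalIntegral.integral_const, smul_eq_mul]
    field_simp
    ring
  rwa [e] at h

/-- The window average of an odd function that is nonpositive on the half-line is nonpositive on the
half-line: the part of the window to the left of `0` is compensated by its mirror image. -/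
theorem windowAverage_nonpos {r : ℝ} (hr : 0 < r) {f : ℝ → ℝ} (hf : Continuous f)
    (hodd : ∀ x, f (-x) = -f x) (hneg : ∀ x, 0 ≤ x → f x ≤ 0) {x : ℝ} (hx : 0 ≤ x) :
    windowAverage r f x ≤ 0 := by
  have hpart : ∀ a b, 0 ≤ a → a ≤ b → ∫ y in a..b, f y ≤ 0 := by
    intro a b ha hab
    have := intervalIntegral.integral_nonneg (μ := volume) (f := fun y => -f y) hab
      fun y hy => neg_nonneg.2 (hneg y (ha.trans hy.1))
    rw [intervalIntegral.integral_neg] at this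
    linarith
  refine div_nonpos_of_nonpos_of_nonneg ?_ (by positivity)
  rcases le_total r x with h | h
  · exact hpart _ _ (by linarith) (by linarith)
  · have h0 : ∫ y in (x - r)..(r - x), f y = 0 := by
      have e := intervalIntegral.integral_comp_neg (a := x - r) (b := r - x) f
      simp only [hodd, intervalIntegral.integral_neg, neg_sub] at e
      linarith
    rw [← intervalIntegral.integral_add_adjacent_intervals (hf.intervalIntegrable _ (r - x))
      (hf.intervalIntegrable _ _), h0, zero_add]
    exact hpart _ _ (by linarith) (by linarith)

/-! ### Smooth odd functions and their two-scale extensions -/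

/-- `h` is odd and twice differentiable, with derivatives `h'` and `h''`, and `h''` is
`M`-Lipschitz. -/
structure IsSmoothOdd (M : ℝ) (h h' h'' : ℝ → ℝ) : Prop where
  hasDerivAt : ∀ x, HasDerivAt h (h' x) x
  hasDerivAt' : ∀ x, HasDerivAt h' (h'' x) x
  lipschitz : ∀ x y, |h'' x - h'' y| ≤ M * |x - y|
  odd : ∀ x, h (-x) = -h x
  odd' : ∀ x, h'' (-x) = -h'' x

theorem continuous_of_abs_sub_le {M : ℝ} {f : ℝ → ℝ} (hM : ∀ x y, |f x - f y| ≤ M * |x - y|) :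
    Continuous f := by
  have hM0 : 0 ≤ M := by simpa using (abs_nonneg _).trans (hM 1 0)
  refine (LipschitzWith.of_dist_le_mul (K := ⟨M, hM0⟩) fun x y => ?_).continuous
  rw [Real.dist_eq, Real.dist_eq]
  exact hM x y

namespace IsSmoothOdd

variable {M : ℝ} {h h' h'' : ℝ → ℝ}

theorem nonneg (H : IsSmoothOdd M h h' h'') : 0 ≤ M := by
  simpa using (abs_nonneg _).trans (H.lipschitz 1 0)

theorem zero (H : IsSmoothOdd M h h' h'') : h 0 = 0 := by
  have := H.odd 0
  rw [neg_zero] at this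
  linarith

theorem zero' (H : IsSmoothOdd M h h' h'') : h'' 0 = 0 := by
  have := H.odd' 0
  rw [neg_zero] at this
  linarith

theorem continuous (H : IsSmoothOdd M h h' h'') : Continuous h :=
  continuous_iff_continuousAt.2 fun x => (H.hasDerivAt x).continuousAt

theorem continuous' (H : IsSmoothOdd M h h' h'') : Continuous h' :=
  continuous_iff_continuousAt.2 fun x => (H.hasDerivAt' x).continuousAt

theorem continuous'' (H : IsSmoothOdd M h h' h'') : Continuous h'' :=
  continuous_of_abs_sub_le H.lipschitz

theorem windowAverage (H : IsSmoothOdd M h h' h'') {r : ℝ} (hr : 0 < r) :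
    IsSmoothOdd M (windowAverage r h) (windowAverage r h') (windowAverage r h'') where
  hasDerivAt := hasDerivAt_windowAverage_of_hasDerivAt H.hasDerivAt H.continuous'
  hasDerivAt' := hasDerivAt_windowAverage_of_hasDerivAt H.hasDerivAt' H.continuous''
  lipschitz := abs_windowAverage_sub_windowAverage_le hr H.continuous'' H.lipschitz
  odd := windowAverage_neg H.odd
  odd' := windowAverage_neg H.odd'

/-- The window average agrees to third order with one step of the heat equation. -/
theorem abs_windowAverage_sub_le (H : IsSmoothOdd M h h' h'') {r : ℝ} (hr : 0 < r) (x : ℝ) :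
    |Bandit.windowAverage r h x - (h x + r ^ 2 / 6 * h'' x)| ≤ M * r ^ 3 := by
  have e := Bandit.abs_windowAverage_sub_le hr H.continuous (x := x) (C := M * r ^ 3)
    (p := fun t => h x + h' x * t + h'' x / 2 * t ^ 2) (by fun_prop) fun t ht => by
      refine (abs_taylor_two_le H.hasDerivAt H.hasDerivAt' H.lipschitz x t).trans ?_
      have := H.nonneg
      gcongr
  have e2 : (∫ t in (-r)..r, (h x + h' x * t + h'' x / 2 * t ^ 2)) / (2 * r) =
      h x + r ^ 2 / 6 * h'' x := by
    rw [intervalIntegral.integral_add (Continuous.intervalIntegrable (by fun_prop) _ _)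
      (Continuous.intervalIntegrable (by fun_prop) _ _), intervalIntegral.integral_add
      (Continuous.intervalIntegrable (by fun_prop) _ _)
      (Continuous.intervalIntegrable (by fun_prop) _ _)]
    have e3 : ∫ t in (-r)..r, h' x * t = 0 := by
      rw [intervalIntegral.integral_const_mul (h' x) (fun t => t), integral_id]
      ring
    rw [e3]
    simp only [intervalIntegral.integral_const_mul, intervalIntegral.integral_const,
      integral_pow, smul_eq_mul]
    field_simp
    ring
  rwa [e2] at e

end IsSmoothOdd

/-- The extension of a function `h` on the half-line to the whole line that is `h` on gains and
the rescaled copy `x ↦ θ⁻¹ * h (θ * x)` on losses (where `h` is meant to be odd). This change of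
scale intertwines the heat flow of `h` with the diffusion that has the low variance on gains and
the high variance on losses. -/
noncomputable def twoScale (θ : ℝ) (h : ℝ → ℝ) (x : ℝ) : ℝ :=
  if 0 ≤ x then h x else θ⁻¹ * h (θ * x)

theorem hasDerivAt_ite {f g f' g' : ℝ → ℝ} (hf : ∀ x, HasDerivAt f (f' x) x)
    (hg : ∀ x, HasDerivAt g (g' x) x) (h0 : f 0 = g 0) (h0' : f' 0 = g' 0) (x : ℝ) :
    HasDerivAt (fun x => if 0 ≤ x then f x else g x) (if 0 ≤ x then f' x else g' x) x := by
  rcases lt_trichotomy x 0 with hx | rfl | hx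
  · rw [if_neg hx.not_ge]
    refine (hg x).congr_of_eventuallyEq ?_
    filter_upwards [Iio_mem_nhds hx] with y hy
    exact if_neg (not_le.2 hy)
  · rw [if_pos le_rfl]
    have h1 : HasDerivWithinAt (fun x => if 0 ≤ x then f x else g x) (f' 0) (Set.Ici 0) 0 :=
      (hf 0).hasDerivWithinAt.congr (fun y hy => if_pos hy) (if_pos le_rfl)
    have h2 : HasDerivWithinAt (fun x => if 0 ≤ x then f x else g x) (f' 0) (Set.Iio 0) 0 := by
      rw [h0']
      exact (hg 0).hasDerivWithinAt.congr (fun y hy => if_neg (not_le.2 hy))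
        ((if_pos le_rfl).trans h0)
    have := h1.union h2
    rwa [Set.Ici_union_Iio, hasDerivWithinAt_univ] at this
  · rw [if_pos hx.le]
    refine (hf x).congr_of_eventuallyEq ?_
    filter_upwards [Ioi_mem_nhds hx] with y hy
    exact if_pos (le_of_lt hy)

theorem abs_ite_sub_ite_le {M : ℝ} {f g : ℝ → ℝ} (hf : ∀ x y, |f x - f y| ≤ M * |x - y|)
    (hg : ∀ x y, |g x - g y| ≤ M * |x - y|) (h0 : f 0 = g 0) (x y : ℝ) :
    |(if 0 ≤ x then f x else g x) - (if 0 ≤ y then f y else g y)| ≤ M * |x - y| := by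
  have cross : ∀ x y, 0 ≤ x → y < 0 → |f x - g y| ≤ M * |x - y| := by
    intro x y hx hy
    have h1 := hf x 0
    have h2 := hg 0 y
    rw [← h0] at h2
    refine (abs_sub_le (f x) (f 0) (g y)).trans ((add_le_add h1 h2).trans_eq ?_)
    rw [sub_zero, zero_sub, abs_neg, abs_of_nonneg hx, abs_of_neg hy,
      abs_of_nonneg (by linarith : 0 ≤ x - y)]
    ring
  split_ifs with hx hy hy
  · exact hf x y
  · exact cross x y hx (not_le.1 hy)
  · rw [abs_sub_comm, abs_sub_comm x y]
    exact cross y x hy (not_le.1 hx)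
  · exact hg x y

theorem twoScale_taylor {M θ : ℝ} (hθ : 0 < θ) (hθ1 : θ ≤ 1) {h h' h'' : ℝ → ℝ}
    (H : IsSmoothOdd M h h' h'') :
    (∀ x, HasDerivAt (twoScale θ h) (if 0 ≤ x then h' x else h' (θ * x)) x) ∧
    (∀ x, HasDerivAt (fun x => if 0 ≤ x then h' x else h' (θ * x))
      (if 0 ≤ x then h'' x else θ * h'' (θ * x)) x) ∧
    (∀ x y, |(if 0 ≤ x then h'' x else θ * h'' (θ * x)) -
      (if 0 ≤ y then h'' y else θ * h'' (θ * y))| ≤ M * |x - y|) := by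
  have hs : ∀ x : ℝ, HasDerivAt (fun x => θ * x) θ x := fun x => by
    simpa using (hasDerivAt_id x).const_mul θ
  refine ⟨?_, ?_, ?_⟩
  · refine hasDerivAt_ite H.hasDerivAt (fun x => ?_) (by simp [H.zero]) (by simp)
    have := ((H.hasDerivAt (θ * x)).comp x (hs x)).const_mul θ⁻¹
    refine this.congr_deriv ?_
    field_simp
  · refine hasDerivAt_ite H.hasDerivAt' (fun x => ?_) (by simp) (by simp [H.zero'])
    have := (H.hasDerivAt' (θ * x)).comp x (hs x)
    exact this.congr_deriv (mul_comm _ _)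
  · refine abs_ite_sub_ite_le H.lipschitz (fun x y => ?_) (by simp [H.zero'])
    have hM := H.nonneg
    have := H.lipschitz (θ * x) (θ * y)
    rw [← mul_sub, abs_mul, abs_of_pos hθ] at this
    rw [← mul_sub, abs_mul, abs_of_pos hθ]
    calc θ * |h'' (θ * x) - h'' (θ * y)| ≤ θ * (M * (θ * |x - y|)) := by gcongr
      _ = θ * θ * (M * |x - y|) := by ring
      _ ≤ 1 * (M * |x - y|) := by
        have : θ * θ ≤ 1 := by nlinarith
        gcongr
      _ = M * |x - y| := one_mul _

theorem abs_twoScale_sub_twoScale_le {θ : ℝ} (hθ : 0 < θ) (hθ1 : θ ≤ 1) {f g : ℝ → ℝ} {δ : ℝ}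
    (h : ∀ x, |f x - g x| ≤ δ) (x : ℝ) : |twoScale θ f x - twoScale θ g x| ≤ θ⁻¹ * δ := by
  have h1 : 1 ≤ θ⁻¹ := (one_le_inv₀ hθ).2 hθ1
  have hδ : 0 ≤ δ := (abs_nonneg _).trans (h 0)
  unfold twoScale
  split_ifs
  · exact (h x).trans (le_mul_of_one_le_left hδ h1)
  · rw [← mul_sub, abs_mul, abs_of_pos (inv_pos.2 hθ)]
    exact mul_le_mul_of_nonneg_left (h _) (inv_nonneg.2 hθ.le)

/-- An odd Lipschitz function is uniformly approximated by smooth odd functions, and if it is concave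
on the half-line then so are the approximations. Averaging twice turns the second derivative into a
second difference quotient, whose sign on the half-line follows from concavity and subadditivity. -/
theorem exists_isSmoothOdd_near {L : ℝ} {ψ : ℝ → ℝ} (hL : ∀ x y, |ψ x - ψ y| ≤ L * |x - y|)
    (hodd : ∀ x, ψ (-x) = -ψ x) {δ : ℝ} (hδ : 0 < δ) :
    ∃ (M : ℝ) (h h' h'' : ℝ → ℝ), IsSmoothOdd M h h' h'' ∧ (∀ x, |h x - ψ x| ≤ δ) ∧
      (ConcaveOn ℝ (Set.Ici 0) ψ → ∀ x, 0 ≤ x → h'' x ≤ 0) := by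
  have hL0 : 0 ≤ L := by simpa using (abs_nonneg _).trans (hL 1 0)
  have hc : Continuous ψ := continuous_of_abs_sub_le hL
  obtain ⟨r, hr, hrδ⟩ : ∃ r : ℝ, 0 < r ∧ 2 * (L * r) ≤ δ := by
    refine ⟨δ / (2 * (L + 1)), by positivity, ?_⟩
    rw [show 2 * (L * (δ / (2 * (L + 1)))) = δ * (L / (L + 1)) by field_simp]
    exact mul_le_of_le_one_right hδ.le ((div_le_one (by positivity)).2 (by linarith))
  have hL1 := abs_windowAverage_sub_windowAverage_le hr hc hL
  have hc1 := continuous_of_abs_sub_le hL1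
  have hd1 : ∀ x, HasDerivAt (windowAverage r ψ) ((ψ (x + r) - ψ (x - r)) / (2 * r)) x :=
    hasDerivAt_windowAverage hc
  let D : ℝ → ℝ := fun x => (ψ (x + 2 * r) - 2 * ψ x + ψ (x - 2 * r)) / (2 * r) ^ 2
  refine ⟨4 * L / (2 * r) ^ 2, windowAverage r (windowAverage r ψ),
    windowAverage r (fun x => (ψ (x + r) - ψ (x - r)) / (2 * r)), D,
    ⟨hasDerivAt_windowAverage_of_hasDerivAt hd1 (by fun_prop), fun x => ?_, fun x y => ?_,
      windowAverage_neg (windowAverage_neg hodd), fun x => ?_⟩, fun x => ?_, fun hconc x hx => ?_⟩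
  · refine (hasDerivAt_windowAverage (r := r)
      (f := fun x => (ψ (x + r) - ψ (x - r)) / (2 * r)) (by fun_prop) x).congr_deriv ?_
    simp only [D, show x + r + r = x + 2 * r by ring, show x - r - r = x - 2 * r by ring,
      add_sub_cancel_right, sub_add_cancel]
    field_simp
    ring
  · simp only [D]
    rw [← sub_div, abs_div, abs_of_pos (by positivity : 0 < (2 * r) ^ 2), div_mul_eq_mul_div]
    refine div_le_div_of_nonneg_right ?_ (by positivity)
    have e1 := hL (x + 2 * r) (y + 2 * r)
    have e2 := hL x y
    have e3 := hL (x - 2 * r) (y - 2 * r)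
    rw [add_sub_add_right_eq_sub] at e1
    rw [sub_sub_sub_cancel_right] at e3
    rw [abs_le] at *
    constructor <;> linarith
  · simp only [D]
    rw [show -x + 2 * r = -(x - 2 * r) by ring, show -x - 2 * r = -(x + 2 * r) by ring, hodd, hodd,
      hodd]
    ring
  · have e1 := abs_windowAverage_sub_self_le hr hc1 hL1 x
    have e2 := abs_windowAverage_sub_self_le hr hc hL x
    exact (abs_sub_le _ _ _).trans ((add_le_add e1 e2).trans (by linarith))
  · refine div_nonpos_of_nonpos_of_nonneg ?_ (by positivity)
    have h0 : ψ 0 = 0 := by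
      have := hodd 0
      rw [neg_zero] at this
      linarith
    have mid : ∀ a b, 0 ≤ a → 0 ≤ b → ψ a + ψ b ≤ 2 * ψ ((a + b) / 2) := by
      intro a b ha hb
      have := hconc.2 (Set.mem_Ici.2 ha) (Set.mem_Ici.2 hb)
        (by norm_num : (0 : ℝ) ≤ 1 / 2) (by norm_num : (0 : ℝ) ≤ 1 / 2) (by norm_num)
      simp only [smul_eq_mul] at this
      rw [show 1 / 2 * a + 1 / 2 * b = (a + b) / 2 by ring] at this
      linarith
    have shrink : ∀ t a, 0 ≤ t → t ≤ 1 → 0 ≤ a → t * ψ a ≤ ψ (t * a) := by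
      intro t a ht ht1 ha
      have := hconc.2 (Set.mem_Ici.2 ha) (Set.mem_Ici.2 (le_refl (0 : ℝ))) ht
        (sub_nonneg.2 ht1) (by ring)
      simpa [h0] using this
    have subadd : ∀ a b, 0 ≤ a → 0 ≤ b → ψ (a + b) ≤ ψ a + ψ b := by
      intro a b ha hb
      rcases (add_nonneg ha hb).eq_or_lt with h | h
      · have ha0 : a = 0 := by linarith
        have hb0 : b = 0 := by linarith
        simp [ha0, hb0, h0]
      · have e1 := shrink (a / (a + b)) (a + b) (by positivity)
          ((div_le_one h).2 (by linarith)) h.le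
        have e2 := shrink (b / (a + b)) (a + b) (by positivity)
          ((div_le_one h).2 (by linarith)) h.le
        rw [div_mul_cancel₀ _ h.ne'] at e1 e2
        have e3 : a / (a + b) * ψ (a + b) + b / (a + b) * ψ (a + b) = ψ (a + b) := by
          field_simp
        linarith
    rcases le_total (2 * r) x with h | h
    · have := mid (x + 2 * r) (x - 2 * r) (by linarith) (by linarith)
      rw [show (x + 2 * r + (x - 2 * r)) / 2 = x by ring] at this
      linarith
    · have e1 := subadd (2 * r - x) (x + x) (by linarith) (by linarith)
      have e2 := subadd x x hx hx
      rw [show 2 * r - x + (x + x) = x + 2 * r by ring] at e1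
      rw [show x - 2 * r = -(2 * r - x) by ring, hodd]
      linarith

/-! ### The invariance principle for two-scale functions -/

theorem exists_abs_outcome_le (Ω : Finset ℝ) : ∃ R : ℝ, ∀ x : Ω, |(x : ℝ)| ≤ R := by
  obtain ⟨R, hR⟩ := (Set.finite_range fun x : Ω => |(x : ℝ)|).bddAbove
  exact ⟨R, fun x => hR ⟨x, rfl⟩⟩

/-- One pull of an arm with variance `v`, compared with one step of the uniform random walk of
variance `σlo ^ 2` in the coordinate where the function is a smooth odd function. Since
`σhi * θ = σlo`, on losses that step corresponds to a pull of variance `σhi ^ 2`. -/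
theorem integral_twoScale_le {Ω : Finset ℝ} {μ : Measure Ω} [IsProbabilityMeasure μ]
    (hμ : ∫ x, (x : ℝ) ∂μ = 0) {R : ℝ} (hR : ∀ x : Ω, |(x : ℝ)| ≤ R) {q : ℝ} (hq : 0 < q)
    {σlo σhi : ℝ} (hpos : 0 < σlo) (hle : σlo ≤ σhi) {M : ℝ} {h h' h'' : ℝ → ℝ}
    (H : IsSmoothOdd M h h' h'') (y : ℝ)
    (hgain : 0 ≤ y → (∫ x, (x : ℝ) ^ 2 ∂μ) * h'' y ≤ σlo ^ 2 * h'' y)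
    (hloss : y < 0 → (∫ x, (x : ℝ) ^ 2 ∂μ) * h'' (σlo / σhi * y) ≤
      σhi ^ 2 * h'' (σlo / σhi * y)) :
    ∫ x : Ω, twoScale (σlo / σhi) h (y + q * x) ∂μ ≤
      twoScale (σlo / σhi) (windowAverage (q * (√3 * σlo)) h) y +
        q ^ 3 * (M * R ^ 3 + (1 + (σlo / σhi)⁻¹) * (M * (√3 * σlo) ^ 3)) := by
  have hhi : 0 < σhi := hpos.trans_le hle
  have hθ : 0 < σlo / σhi := div_pos hpos hhi
  have hθe : σhi * (σlo / σhi) = σlo := by field_simp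
  obtain ⟨h1, h2, h3⟩ := twoScale_taylor hθ ((div_le_one hhi).2 hle) H
  have hT := (abs_le.1 (abs_integral_taylor_two_le hμ hR hq.le h1 h2 h3 y)).2
  have hW := fun z => (abs_le.1 (H.abs_windowAverage_sub_le
    (r := q * (√3 * σlo)) (by positivity) z)).1
  have hM := H.nonneg
  set v := ∫ x : Ω, (x : ℝ) ^ 2 ∂μ
  set θ := σlo / σhi
  set E := M * (√3 * σlo) ^ 3
  have hE : 0 ≤ E := by positivity
  have hr2 : (q * (√3 * σlo)) ^ 2 / 6 = q ^ 2 / 2 * σlo ^ 2 := by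
    rw [mul_pow, mul_pow, Real.sq_sqrt (by norm_num)]
    ring
  have hr3 : M * (q * (√3 * σlo)) ^ 3 = q ^ 3 * E := by simp only [E]; ring
  simp only [hr2, hr3] at hW
  have hq3 : 0 ≤ q ^ 3 * E := by positivity
  rcases le_or_gt 0 y with hy | hy
  · have hg := mul_le_mul_of_nonneg_left (hgain hy) (by positivity : 0 ≤ q ^ 2 / 2)
    have hWy := hW y
    rw [if_pos hy] at hT
    rw [show twoScale θ (windowAverage (q * (√3 * σlo)) h) y =
      windowAverage (q * (√3 * σlo)) h y from if_pos hy]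
    rw [show twoScale θ h y = h y from if_pos hy] at hT
    have : 0 ≤ θ⁻¹ * (q ^ 3 * E) := by positivity
    nlinarith
  · have hg := mul_le_mul_of_nonneg_left (hloss hy) (by positivity : 0 ≤ q ^ 2 / 2 * θ)
    have hWy := mul_le_mul_of_nonneg_left (hW (θ * y)) (inv_nonneg.2 hθ.le)
    rw [if_neg hy.not_ge] at hT
    rw [show twoScale θ (windowAverage (q * (√3 * σlo)) h) y =
      θ⁻¹ * windowAverage (q * (√3 * σlo)) h (θ * y) from if_neg hy.not_ge]
    rw [show twoScale θ h y = θ⁻¹ * h (θ * y) from if_neg hy.not_ge] at hT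
    have e : θ⁻¹ * (q ^ 2 / 2 * σlo ^ 2 * h'' (θ * y)) =
        q ^ 2 / 2 * θ * (σhi ^ 2 * h'' (θ * y)) := by
      rw [← hθe]
      field_simp
    nlinarith

theorem action_switchingStrategy {A : Type*} {Ω : Finset ℝ} (aHi aLo : A) (n : ℕ) (ω : ℕ → Ω) :
    action (switchingStrategy aHi aLo) n ω = if gains n ω ≤ 0 then aHi else aLo := by
  simp only [action, switchingStrategy, Beliefs.gains_eq_sum_outcomeHistory]

namespace Beliefs

variable {A : Type*} {Ω : Finset ℝ}

theorem integral_sq_priorLaw (B : Beliefs A Ω) (a : A) :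
    ∫ x, (x : ℝ) ^ 2 ∂(B.priorLaw a) = B.sd a ^ 2 :=
  (Real.sq_sqrt (integral_nonneg fun _ => sq_nonneg _)).symm

instance (B : Beliefs A Ω) (a : A) : IsProbabilityMeasure (B.priorLaw a) :=
  B.isProbabilityMeasure _ _ _ _

theorem integral_priorLaw (B : Beliefs A Ω) (hmean : B.MeanZero) (a : A) :
    ∫ x, (x : ℝ) ∂(B.priorLaw a) = 0 :=
  hmean _ _ _ _

/-- The expectation of a smooth two-scale function is at most of order `1 / √n`, both for all
strategies if the function is concave on gains (and so convex on losses), since then the low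
variance is best on gains and the high variance is best on losses, and for the switching strategy
in any case, since it always has exactly the variance that makes the comparison an equality. -/
theorem integral_twoScale_gains_le (B : Beliefs A Ω) (hnl : B.NoLearning) (hmean : B.MeanZero)
    {σlo σhi : ℝ} (hpos : 0 < σlo) (hle : σlo ≤ σhi) (hlo : ∀ a, σlo ≤ B.sd a)
    (hhi : ∀ a, B.sd a ≤ σhi) {aHi aLo : A} (haHi : B.sd aHi = σhi) (haLo : B.sd aLo = σlo)
    {R : ℝ} (hR : ∀ x : Ω, |(x : ℝ)| ≤ R) {M : ℝ} {h h' h'' : ℝ → ℝ} (H : IsSmoothOdd M h h' h'')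
    (s : Strategy A Ω)
    (hs : (∀ x, 0 ≤ x → h'' x ≤ 0) ∨ s = switchingStrategy aHi aLo) {n : ℕ} (hn : 0 < n) :
    ∫ ω, twoScale (σlo / σhi) h (gains n ω / √n) ∂(B.pathMeasure s) ≤
      (√n)⁻¹ * (M * R ^ 3 + (1 + (σlo / σhi)⁻¹) * (M * (√3 * σlo) ^ 3)) := by
  have hσhi : 0 < σhi := hpos.trans_le hle
  have hθ : 0 < σlo / σhi := div_pos hpos hσhi
  have hn' : (0 : ℝ) < n := by exact_mod_cast hn
  set q : ℝ := (√n)⁻¹ with hqdef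
  have hq : 0 < q := by positivity
  have hnq : (n : ℝ) * q ^ 2 = 1 := by
    rw [hqdef, inv_pow, Real.sq_sqrt hn'.le]
    field_simp
  set r := q * (√3 * σlo) with hrdef
  have hr : 0 < r := by positivity
  have hiter : ∀ k, IsSmoothOdd M ((windowAverage r)^[k] h) ((windowAverage r)^[k] h')
      ((windowAverage r)^[k] h'') := by
    intro k
    induction k with
    | zero => exact H
    | succ k ih =>
      simp only [Function.iterate_succ_apply']
      exact ih.windowAverage hr
  have hsign : (∀ k x, 0 ≤ x → (windowAverage r)^[k] h'' x ≤ 0) ∨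
      s = switchingStrategy aHi aLo := by
    refine hs.imp_left fun hneg k => ?_
    induction k with
    | zero => exact hneg
    | succ k ih =>
      intro x hx
      rw [Function.iterate_succ_apply']
      exact windowAverage_nonpos hr (hiter k).continuous'' (hiter k).odd' ih hx
  set K := M * R ^ 3 + (1 + (σlo / σhi)⁻¹) * (M * (√3 * σlo) ^ 3)
  have main := B.integral_gains_le hnl s n
    (fun k z => twoScale (σlo / σhi) ((windowAverage r)^[k] h) (q * z)) (q ^ 3 * K) ?_
  · have hz : twoScale (σlo / σhi) ((windowAverage r)^[n] h) (q * 0) = 0 := by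
      rw [mul_zero, twoScale, if_pos le_rfl, (hiter n).zero]
    rw [hz, zero_add, show (n : ℝ) * (q ^ 3 * K) = n * q ^ 2 * (q * K) by ring, hnq, one_mul] at main
    simpa only [div_eq_inv_mul, Function.iterate_zero, id] using main
  · intro k i ω _
    have hmon : ∀ a, B.sd a ^ 2 ≤ σhi ^ 2 ∧ σlo ^ 2 ≤ B.sd a ^ 2 := fun a =>
      ⟨pow_le_pow_left₀ (Real.sqrt_nonneg _) (hhi a) 2, pow_le_pow_left₀ hpos.le (hlo a) 2⟩
    simp only [mul_add, Function.iterate_succ_apply']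
    refine integral_twoScale_le (B.integral_priorLaw hmean _) hR hq hpos hle (hiter k) _
      (fun hy => ?_) (fun hy => ?_)
    · rw [integral_sq_priorLaw]
      rcases hsign with hneg | rfl
      · exact mul_le_mul_of_nonpos_right (hmon _).2 (hneg k _ hy)
      · rcases (nonneg_of_mul_nonneg_right hy hq).eq_or_lt with h0 | h0
        · rw [← h0, mul_zero, (hiter k).zero', mul_zero, mul_zero]
        · rw [action_switchingStrategy, if_neg h0.not_ge, haLo]
    · rw [integral_sq_priorLaw]
      rcases hsign with hneg | rfl
      · have hy' : 0 ≤ -(σlo / σhi * (q * gains i ω)) :=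
          neg_nonneg.2 (mul_nonpos_of_nonneg_of_nonpos hθ.le hy.le)
        have h1 := hneg k _ hy'
        rw [(hiter k).odd', neg_nonpos] at h1
        exact mul_le_mul_of_nonneg_right (hmon _).1 h1
      · rw [action_switchingStrategy, if_pos (le_of_lt (by nlinarith)), haHi]

/-- The bound of `integral_twoScale_gains_le` in the limit, with the smoothness removed by
approximation. It is uniform in the strategy if `ψ` is concave on gains. -/
theorem eventually_integral_twoScale_gains_le (B : Beliefs A Ω) (hnl : B.NoLearning)
    (hmean : B.MeanZero) {σlo σhi : ℝ} (hpos : 0 < σlo) (hle : σlo ≤ σhi)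
    (hlo : ∀ a, σlo ≤ B.sd a) (hhi : ∀ a, B.sd a ≤ σhi) {aHi aLo : A} (haHi : B.sd aHi = σhi)
    (haLo : B.sd aLo = σlo) {L : ℝ} {ψ : ℝ → ℝ} (hL : ∀ x y, |ψ x - ψ y| ≤ L * |x - y|)
    (hodd : ∀ x, ψ (-x) = -ψ x) {δ : ℝ} (hδ : 0 < δ) :
    ∀ᶠ n : ℕ in atTop, ∀ s : Strategy A Ω,
      (ConcaveOn ℝ (Set.Ici 0) ψ ∨ s = switchingStrategy aHi aLo) →
      ∫ ω, twoScale (σlo / σhi) ψ (gains n ω / √n) ∂(B.pathMeasure s) ≤ δ := by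
  have hσhi : 0 < σhi := hpos.trans_le hle
  have hθ : 0 < σlo / σhi := div_pos hpos hσhi
  obtain ⟨R, hR⟩ := exists_abs_outcome_le Ω
  obtain ⟨M, h, h', h'', H, hnear, hconc⟩ := exists_isSmoothOdd_near hL hodd
    (δ := σlo / σhi * (δ / 2)) (by positivity)
  have hlim : Tendsto (fun n : ℕ => (√(n : ℝ))⁻¹ *
      (M * R ^ 3 + (1 + (σlo / σhi)⁻¹) * (M * (√3 * σlo) ^ 3))) atTop (𝓝 0) := by
    have := (tendsto_inv_atTop_zero.comp
      (Real.tendsto_sqrt_atTop.comp tendsto_natCast_atTop_atTop)).mul_const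
      (M * R ^ 3 + (1 + (σlo / σhi)⁻¹) * (M * (√3 * σlo) ^ 3))
    rwa [zero_mul] at this
  filter_upwards [hlim.eventually_le_const (half_pos hδ), eventually_gt_atTop 0] with n hn hn0 s hs
  have h1 := B.integral_twoScale_gains_le hnl hmean hpos hle hlo hhi haHi haLo hR H s
    (hs.imp_left hconc) hn0
  have h2 : ∫ ω, twoScale (σlo / σhi) ψ (gains n ω / √n) ∂(B.pathMeasure s) ≤
      ∫ ω, (twoScale (σlo / σhi) h (gains n ω / √n) + δ / 2) ∂(B.pathMeasure s) := by
    refine integral_mono (B.integrable_comp_gains s n fun z => twoScale (σlo / σhi) ψ (z / √n))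
      ((B.integrable_comp_gains s n fun z => twoScale (σlo / σhi) h (z / √n)).add
        (integrable_const _)) fun ω => ?_
    have := (abs_le.1 (abs_twoScale_sub_twoScale_le hθ ((div_le_one hσhi).2 hle) hnear
      (gains n ω / √n))).1
    rw [inv_mul_cancel_left₀ hθ.ne'] at this
    simp only
    linarith
  rw [integral_add (B.integrable_comp_gains s n fun z => twoScale (σlo / σhi) h (z / √n))
    (integrable_const _)] at h2
  simp only [integral_const, probReal_univ, one_smul] at h2
  linarith

/-- Under the switching strategy the limit law of the normalized gains integrates every two-scale
function to `0`. -/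
theorem tendsto_integral_twoScale_gains (B : Beliefs A Ω) (hnl : B.NoLearning)
    (hmean : B.MeanZero) {σlo σhi : ℝ} (hpos : 0 < σlo) (hle : σlo ≤ σhi)
    (hlo : ∀ a, σlo ≤ B.sd a) (hhi : ∀ a, B.sd a ≤ σhi) {aHi aLo : A} (haHi : B.sd aHi = σhi)
    (haLo : B.sd aLo = σlo) {L : ℝ} {ψ : ℝ → ℝ} (hL : ∀ x y, |ψ x - ψ y| ≤ L * |x - y|)
    (hodd : ∀ x, ψ (-x) = -ψ x) :
    Tendsto (fun n : ℕ => ∫ ω, twoScale (σlo / σhi) ψ (gains n ω / √n)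
      ∂(B.pathMeasure (switchingStrategy aHi aLo))) atTop (𝓝 0) := by
  have hL' : ∀ x y, |-ψ x - -ψ y| ≤ L * |x - y| := fun x y => by
    rw [← abs_neg]
    simpa [add_comm, sub_eq_add_neg] using hL x y
  refine Metric.tendsto_nhds.2 fun ε hε => ?_
  filter_upwards [B.eventually_integral_twoScale_gains_le hnl hmean hpos hle hlo hhi haHi haLo hL
    hodd (half_pos hε), B.eventually_integral_twoScale_gains_le hnl hmean hpos hle hlo hhi haHi haLo
    (ψ := fun x => -ψ x) hL' (fun x => by rw [hodd]) (half_pos hε)] with n h1 h2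
  have e1 := h1 _ (Or.inr rfl)
  have e2 := h2 _ (Or.inr rfl)
  have hneg : ∀ x, twoScale (σlo / σhi) (fun x => -ψ x) x = -twoScale (σlo / σhi) ψ x := by
    intro x
    unfold twoScale
    split_ifs <;> ring
  simp only [hneg, integral_neg] at e2
  rw [Real.dist_eq, sub_zero, abs_lt]
  constructor <;> linarith

end Beliefs

/-! ### Gaussian supersolutions and the probability of small gains -/

theorem hasDerivAt_gaussian (x : ℝ) :
    HasDerivAt (fun x : ℝ => Real.exp (-(x ^ 2 / 2))) (-x * Real.exp (-(x ^ 2 / 2))) x := by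
  have := ((((hasDerivAt_id x).pow 2).div_const 2).fun_neg).exp
  refine this.congr_deriv ?_
  simp
  ring

theorem hasDerivAt_gaussian' (x : ℝ) :
    HasDerivAt (fun x : ℝ => -x * Real.exp (-(x ^ 2 / 2)))
      ((x ^ 2 - 1) * Real.exp (-(x ^ 2 / 2))) x := by
  refine ((hasDerivAt_id x).fun_neg.mul (hasDerivAt_gaussian x)).congr_deriv ?_
  simp
  ring

theorem hasDerivAt_gaussian'' (x : ℝ) :
    HasDerivAt (fun x : ℝ => (x ^ 2 - 1) * Real.exp (-(x ^ 2 / 2)))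
      ((3 * x - x ^ 3) * Real.exp (-(x ^ 2 / 2))) x := by
  refine ((((hasDerivAt_id x).pow 2).sub_const 1).mul (hasDerivAt_gaussian x)).congr_deriv ?_
  simp
  ring

theorem abs_gaussian''_sub_le (x y : ℝ) :
    |(x ^ 2 - 1) * Real.exp (-(x ^ 2 / 2)) - (y ^ 2 - 1) * Real.exp (-(y ^ 2 / 2))| ≤
      4 * |x - y| := by
  refine convex_univ.norm_image_sub_le_of_norm_hasDerivWithin_le
    (fun z _ => (hasDerivAt_gaussian'' z).hasDerivWithinAt) (fun z _ => ?_) (Set.mem_univ y)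
    (Set.mem_univ x)
  rw [Real.norm_eq_abs, abs_mul, abs_of_pos (Real.exp_pos _), Real.exp_neg,
    ← div_eq_mul_inv, div_le_iff₀ (Real.exp_pos _)]
  have hexp := Real.quadratic_le_exp_of_nonneg (x := z ^ 2 / 2) (by positivity)
  have hz : |3 * z - z ^ 3| ≤ |z| * (3 + z ^ 2) := by
    rw [show 3 * z - z ^ 3 = z * (3 - z ^ 2) by ring, abs_mul]
    refine mul_le_mul_of_nonneg_left (abs_le.2 ⟨?_, ?_⟩) (abs_nonneg _) <;> nlinarith [sq_nonneg z]
  have h2 : |z| ≤ (1 + z ^ 2) / 2 := by nlinarith [sq_nonneg (|z| - 1), sq_abs z]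
  have h3 : |z| * (3 + z ^ 2) ≤ (1 + z ^ 2) / 2 * (3 + z ^ 2) :=
    mul_le_mul_of_nonneg_right h2 (by positivity)
  nlinarith

/-- The Gaussian profile `t ^ (-α) * exp (-x ^ 2 / (2 * b * t))`. If `b` dominates all variances and
`2 * α * b` is dominated by all variances, then it is a supersolution of every heat equation with
such variances, and so it bounds from above the chance of ending near `0` under any strategy. -/
noncomputable def gaussianProfile (α b t x : ℝ) : ℝ :=
  Real.exp (-(α * Real.log t)) * Real.exp (-(x ^ 2 / (2 * b * t)))

theorem gaussianProfile_pos (α b t x : ℝ) : 0 < gaussianProfile α b t x := by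
  unfold gaussianProfile
  positivity

theorem gaussianProfile_add_ge {α b t d : ℝ} (hα : 0 ≤ α) (hb : 0 < b) (ht : 0 < t) (hd : 0 ≤ d)
    (x : ℝ) :
    gaussianProfile α b t x * (1 + d * (x ^ 2 / (2 * b * t ^ 2) - α / t)) -
      d ^ 2 * (Real.exp (-(α * Real.log t)) / t ^ 2) ≤ gaussianProfile α b (t + d) x := by
  have htd : 0 < t + d := by linarith
  set w := x ^ 2 / (2 * b * t) with hw
  have hw0 : 0 ≤ w := by positivity
  set Δ := -(α * (Real.log (t + d) - Real.log t)) + w * (d / (t + d)) with hΔ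
  have hsplit : gaussianProfile α b (t + d) x = gaussianProfile α b t x * Real.exp Δ := by
    simp only [gaussianProfile, ← Real.exp_add]
    congr 1
    simp only [hΔ, hw]
    field_simp
    ring
  have hlog : Real.log (t + d) - Real.log t ≤ d / t := by
    rw [← Real.log_div htd.ne' ht.ne']
    refine (Real.log_le_sub_one_of_pos (by positivity)).trans_eq ?_
    field_simp
    ring
  have hfrac : d / t - d ^ 2 / t ^ 2 ≤ d / (t + d) := by
    rw [← sub_nonneg]
    have : d / (t + d) - (d / t - d ^ 2 / t ^ 2) = d ^ 3 / (t ^ 2 * (t + d)) := by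
      field_simp
      ring
    rw [this]
    positivity
  have hΔge : d * (x ^ 2 / (2 * b * t ^ 2) - α / t) - d ^ 2 / t ^ 2 * w ≤ Δ := by
    have e1 := mul_le_mul_of_nonneg_left hlog hα
    have e2 := mul_le_mul_of_nonneg_left hfrac hw0
    have e3 : d * (x ^ 2 / (2 * b * t ^ 2) - α / t) - d ^ 2 / t ^ 2 * w =
        w * (d / t - d ^ 2 / t ^ 2) - α * (d / t) := by
      simp only [hw]
      field_simp
      ring
    rw [e3, hΔ]
    linarith
  have hexp := Real.add_one_le_exp Δ
  -- The expansion in time has an error proportional to `d ^ 2 * w`; the decay of the profile in `w`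
  -- makes it uniform in `x`.
  have hdecay : gaussianProfile α b t x * w ≤ Real.exp (-(α * Real.log t)) := by
    rw [gaussianProfile, mul_assoc]
    refine mul_le_of_le_one_right (Real.exp_pos _).le ?_
    rw [Real.exp_neg, inv_mul_le_iff₀ (Real.exp_pos _), mul_one]
    linarith [Real.add_one_le_exp w]
  have h1 : gaussianProfile α b t x *
      (1 + (d * (x ^ 2 / (2 * b * t ^ 2) - α / t) - d ^ 2 / t ^ 2 * w)) ≤
      gaussianProfile α b t x * Real.exp Δ :=
    mul_le_mul_of_nonneg_left (by linarith) (gaussianProfile_pos _ _ _ _).le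
  have h2 := mul_le_mul_of_nonneg_left hdecay (by positivity : 0 ≤ d ^ 2 / t ^ 2)
  rw [hsplit]
  have e : d ^ 2 * (Real.exp (-(α * Real.log t)) / t ^ 2) =
    d ^ 2 / t ^ 2 * Real.exp (-(α * Real.log t)) := by ring
  rw [e]
  linarith

/-- One pull of an arm, as seen through the Gaussian profile. -/
theorem integral_gaussianProfile_le {Ω : Finset ℝ} {μ : Measure Ω} [IsProbabilityMeasure μ]
    (hμ : ∫ x, (x : ℝ) ∂μ = 0) {R : ℝ} (hR : ∀ x : Ω, |(x : ℝ)| ≤ R) {q : ℝ} (hq : 0 ≤ q)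
    {α b a t : ℝ} (hα : 0 ≤ α) (hb : 0 < b) (ha : 0 < a) (hat : a ≤ t)
    (hvb : ∫ x, (x : ℝ) ^ 2 ∂μ ≤ b) (hvα : 2 * α * b ≤ ∫ x, (x : ℝ) ^ 2 ∂μ) (y : ℝ) :
    ∫ x : Ω, gaussianProfile α b t (y + q * x) ∂μ ≤ gaussianProfile α b (t + q ^ 2) y +
      (4 * Real.exp (-(α * Real.log a)) * ((√(b * a))⁻¹) ^ 3 * (q * R) ^ 3 +
        q ^ 4 * (Real.exp (-(α * Real.log a)) / a ^ 2)) := by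
  have ht : 0 < t := ha.trans_le hat
  set v := ∫ x : Ω, (x : ℝ) ^ 2 ∂μ
  set c := Real.exp (-(α * Real.log t)) with hcdef
  set κ := (√(b * t))⁻¹ with hκdef
  have hc : 0 < c := Real.exp_pos _
  have hκ : 0 < κ := by positivity
  have hκ2 : κ ^ 2 = 1 / (b * t) := by
    rw [hκdef, inv_pow, Real.sq_sqrt (by positivity), one_div]
  have hR0 : 0 ≤ R := by
    obtain ⟨x⟩ : Nonempty Ω := by
      by_contra hne
      rw [not_nonempty_iff] at hne
      exact IsProbabilityMeasure.ne_zero μ (Subsingleton.elim _ _)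
    exact (abs_nonneg _).trans (hR x)
  have hg : ∀ x, gaussianProfile α b t x = c * Real.exp (-((κ * x) ^ 2 / 2)) := by
    intro x
    rw [gaussianProfile, mul_pow, hκ2]
    congr 3
    field_simp
  have hs : ∀ x : ℝ, HasDerivAt (fun x => κ * x) κ x := fun x => by
    simpa using (hasDerivAt_id x).const_mul κ
  have h1 : ∀ x, HasDerivAt (gaussianProfile α b t)
      (c * κ * (-(κ * x) * Real.exp (-((κ * x) ^ 2 / 2)))) x := by
    intro x
    rw [funext hg]
    exact (((hasDerivAt_gaussian (κ * x)).comp x (hs x)).const_mul c).congr_deriv (by ring)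
  have h2 : ∀ x, HasDerivAt (fun x => c * κ * (-(κ * x) * Real.exp (-((κ * x) ^ 2 / 2))))
      (c * κ ^ 2 * (((κ * x) ^ 2 - 1) * Real.exp (-((κ * x) ^ 2 / 2)))) x := fun x =>
    (((hasDerivAt_gaussian' (κ * x)).comp x (hs x)).const_mul (c * κ)).congr_deriv (by ring)
  have h3 : ∀ x y, |c * κ ^ 2 * (((κ * x) ^ 2 - 1) * Real.exp (-((κ * x) ^ 2 / 2))) -
      c * κ ^ 2 * (((κ * y) ^ 2 - 1) * Real.exp (-((κ * y) ^ 2 / 2)))| ≤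
      4 * c * κ ^ 3 * |x - y| := by
    intro x y
    rw [← mul_sub, abs_mul, abs_of_pos (by positivity : 0 < c * κ ^ 2)]
    refine (mul_le_mul_of_nonneg_left (abs_gaussian''_sub_le (κ * x) (κ * y))
      (by positivity)).trans_eq ?_
    rw [← mul_sub, abs_mul, abs_of_pos hκ]
    ring
  have hT := (abs_le.1 (abs_integral_taylor_two_le hμ hR hq h1 h2 h3 y)).2
  have hadd := gaussianProfile_add_ge hα hb ht (sq_nonneg q) y
  have hgen : v / 2 * (c * κ ^ 2 * (((κ * y) ^ 2 - 1) * Real.exp (-((κ * y) ^ 2 / 2)))) ≤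
      gaussianProfile α b t y * (y ^ 2 / (2 * b * t ^ 2) - α / t) := by
    have e : v / 2 * (c * κ ^ 2 * (((κ * y) ^ 2 - 1) * Real.exp (-((κ * y) ^ 2 / 2)))) =
        gaussianProfile α b t y * (v / b * (y ^ 2 / (2 * b * t ^ 2)) - v / (2 * b) / t) := by
      rw [hg, mul_pow, hκ2]
      field_simp
    rw [e]
    refine mul_le_mul_of_nonneg_left ?_ (gaussianProfile_pos _ _ _ _).le
    have e1 : v / b * (y ^ 2 / (2 * b * t ^ 2)) ≤ y ^ 2 / (2 * b * t ^ 2) :=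
      mul_le_of_le_one_left (by positivity) ((div_le_one hb).2 hvb)
    have e2 : α / t ≤ v / (2 * b) / t := by
      refine div_le_div_of_nonneg_right ?_ ht.le
      rw [le_div_iff₀ (by positivity)]
      linarith
    linarith
  have hcle : c ≤ Real.exp (-(α * Real.log a)) :=
    Real.exp_le_exp.2 (neg_le_neg (mul_le_mul_of_nonneg_left (Real.log_le_log ha hat) hα))
  have hκle : κ ≤ (√(b * a))⁻¹ := by
    rw [hκdef]
    gcongr
  have hE1 : 4 * c * κ ^ 3 * (q * R) ^ 3 ≤
      4 * Real.exp (-(α * Real.log a)) * ((√(b * a))⁻¹) ^ 3 * (q * R) ^ 3 := by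
    gcongr
  have hE2 : q ^ 4 * (c / t ^ 2) ≤ q ^ 4 * (Real.exp (-(α * Real.log a)) / a ^ 2) := by
    gcongr
  have hmul := mul_le_mul_of_nonneg_left hgen (sq_nonneg q)
  rw [show (q ^ 2) ^ 2 = q ^ 4 by ring] at hadd
  nlinarith

/-- The normalized gains rarely end near `0`, whatever the strategy. -/
theorem Beliefs.exists_eventually_measureReal_abs_gains_le {A : Type*} {Ω : Finset ℝ}
    (B : Beliefs A Ω) (hnl : B.NoLearning) (hmean : B.MeanZero) {σlo σhi : ℝ} (hpos : 0 < σlo)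
    (hle : σlo ≤ σhi) (hlo : ∀ a, σlo ≤ B.sd a) (hhi : ∀ a, B.sd a ≤ σhi) (s : Strategy A Ω)
    {δ : ℝ} (hδ : 0 < δ) :
    ∃ η > 0, ∀ᶠ n : ℕ in atTop, (B.pathMeasure s).real {ω | |gains n ω / √n| ≤ η} ≤ δ := by
  have hσhi : 0 < σhi := hpos.trans_le hle
  obtain ⟨R, hR⟩ := exists_abs_outcome_le Ω
  set b := σhi ^ 2 with hb
  set α := σlo ^ 2 / (2 * σhi ^ 2) with hα
  have hb0 : 0 < b := by positivity
  have hα0 : 0 < α := by positivity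
  have hαb : 2 * α * b = σlo ^ 2 := by
    rw [hα, hb]
    field_simp
  -- On `|x| ≤ √a` the profile at time `a` is at least `m⁻¹`, and `m` is small with `a`.
  obtain ⟨a, ha, hm⟩ : ∃ a : ℝ, 0 < a ∧ Real.exp (α * Real.log a + 1 / (2 * b)) ≤ δ / 2 := by
    refine ⟨Real.exp ((Real.log (δ / 2) - 1 / (2 * b)) / α), Real.exp_pos _, ?_⟩
    rw [Real.log_exp, mul_div_cancel₀ _ hα0.ne', sub_add_cancel, Real.exp_log (half_pos hδ)]
  set m := Real.exp (α * Real.log a + 1 / (2 * b))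
  have hm0 : 0 < m := Real.exp_pos _
  set C₁ := 4 * Real.exp (-(α * Real.log a)) * ((√(b * a))⁻¹) ^ 3 * R ^ 3 with hC₁
  set C₂ := Real.exp (-(α * Real.log a)) / a ^ 2 with hC₂
  refine ⟨√a, by positivity, ?_⟩
  have hlim : Tendsto (fun n : ℕ => C₁ * (√(n : ℝ))⁻¹ + C₂ * (√(n : ℝ))⁻¹ ^ 2) atTop (𝓝 0) := by
    have h := tendsto_inv_atTop_zero.comp
      (Real.tendsto_sqrt_atTop.comp (tendsto_natCast_atTop_atTop (R := ℝ)))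
    have := (h.const_mul C₁).add ((h.pow 2).const_mul C₂)
    simpa using this
  filter_upwards [hlim.eventually_le_const one_pos, eventually_gt_atTop 0] with n hn hn0
  have hn' : (0 : ℝ) < n := by exact_mod_cast hn0
  set q : ℝ := (√n)⁻¹ with hqdef
  have hq : 0 < q := by positivity
  have hnq : (n : ℝ) * q ^ 2 = 1 := by
    rw [hqdef, inv_pow, Real.sq_sqrt hn'.le]
    field_simp
  have main := B.integral_gains_le hnl s n
    (fun k z => gaussianProfile α b (a + k * q ^ 2) (q * z)) (C₁ * q ^ 3 + C₂ * q ^ 4) ?_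
  · have hz : gaussianProfile α b (a + 1) (q * 0) ≤ 1 := by
      rw [gaussianProfile, ← Real.exp_add]
      refine Real.exp_le_one_iff.2 ?_
      have : 0 ≤ α * Real.log (a + 1) := mul_nonneg hα0.le (Real.log_nonneg (by linarith))
      simpa using this
    have he : (n : ℝ) * (C₁ * q ^ 3 + C₂ * q ^ 4) = n * q ^ 2 * (C₁ * q + C₂ * q ^ 2) := by ring
    rw [he, hnq, one_mul] at main
    have hmain : ∫ ω, gaussianProfile α b a (q * gains n ω) ∂(B.pathMeasure s) ≤ 2 := by
      simp only [Nat.cast_zero, zero_mul, add_zero] at main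
      linarith
    have hmeas : MeasurableSet {ω : ℕ → Ω | |gains n ω / √n| ≤ √a} := by
      have : Measurable (gains (Ω := Ω) n) := by
        unfold gains
        fun_prop
      exact measurableSet_le (by fun_prop) measurable_const
    have hind : (B.pathMeasure s).real {ω | |gains n ω / √n| ≤ √a} ≤
        ∫ ω, m * gaussianProfile α b a (q * gains n ω) ∂(B.pathMeasure s) := by
      rw [← integral_indicator_one hmeas]
      refine integral_mono ((integrable_const 1).indicator hmeas)
        (B.integrable_comp_gains s n fun z => m * gaussianProfile α b a (q * z)) fun ω => ?_
      rw [Set.indicator_apply]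
      split_ifs with hω
      swap
      · exact (mul_pos hm0 (gaussianProfile_pos _ _ _ _)).le
      simp only [Set.mem_ofPred_eq, div_eq_inv_mul] at hω
      have hsq : (q * gains n ω) ^ 2 ≤ a := by
        have := pow_le_pow_left₀ (abs_nonneg _) hω 2
        rwa [sq_abs, Real.sq_sqrt ha.le] at this
      rw [gaussianProfile, ← Real.exp_add, ← Real.exp_add]
      refine Real.one_le_exp ?_
      have : (q * gains n ω) ^ 2 / (2 * b * a) ≤ 1 / (2 * b) := by
        rw [div_le_div_iff₀ (by positivity) (by positivity)]
        nlinarith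
      linarith
    rw [integral_const_mul] at hind
    have := mul_le_mul_of_nonneg_left hmain hm0.le
    linarith
  · intro k i ω _
    have hsd := B.integral_sq_priorLaw (action s i ω)
    have h := integral_gaussianProfile_le (B.integral_priorLaw hmean (action s i ω)) hR hq.le
      hα0.le hb0 ha (t := a + k * q ^ 2) (le_add_of_nonneg_right (by positivity))
      (hsd.trans_le (pow_le_pow_left₀ (Real.sqrt_nonneg _) (hhi _) 2))
      ((hαb.trans_le (pow_le_pow_left₀ hpos.le (hlo _) 2)).trans_eq hsd.symm) (q * gains i ω)
    simp only [mul_add]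
    refine h.trans_eq ?_
    rw [hC₁, hC₂]
    push_cast
    ring_nf

/-! ### The limiting probability of gains -/

/-- The odd piecewise linear approximation of the sign function with slope `ε⁻¹` at `0`. -/
noncomputable def smoothSign (ε x : ℝ) : ℝ := max (-1) (min 1 (x / ε))

theorem abs_smoothSign_sub_le {ε : ℝ} (hε : 0 < ε) (x y : ℝ) :
    |smoothSign ε x - smoothSign ε y| ≤ ε⁻¹ * |x - y| := by
  have h1 := abs_max_sub_max_le_abs (min 1 (x / ε)) (min 1 (y / ε)) (-1)
  have h2 := abs_min_sub_min_le_max 1 (x / ε) 1 (y / ε)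
  rw [sub_self, abs_zero, max_eq_right (abs_nonneg _), ← sub_div, abs_div, abs_of_pos hε] at h2
  rw [max_comm _ (-1), max_comm _ (-1)] at h1
  exact (h1.trans h2).trans_eq (div_eq_inv_mul _ _)

theorem smoothSign_neg (ε x : ℝ) : smoothSign ε (-x) = -smoothSign ε x := by
  rw [smoothSign, smoothSign, ← min_neg_neg, neg_neg, ← max_neg_neg, neg_div, min_max_distrib_left,
    min_eq_right (by norm_num : (-1 : ℝ) ≤ 1)]

theorem smoothSign_of_le {ε x : ℝ} (hε : 0 < ε) (h : ε ≤ x) : smoothSign ε x = 1 := by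
  rw [smoothSign, min_eq_left ((one_le_div hε).2 h), max_eq_right (by norm_num)]

theorem smoothSign_nonneg {ε x : ℝ} (hε : 0 < ε) (h : 0 ≤ x) : 0 ≤ smoothSign ε x :=
  le_max_of_le_right (le_min zero_le_one (by positivity))

theorem smoothSign_le_one (ε x : ℝ) : smoothSign ε x ≤ 1 :=
  max_le (by norm_num) (min_le_left _ _)

/-- The two-scale extension of the sign function is, up to a factor, the centred indicator function
of gains; the smooth sign only changes it near `0`. -/
theorem abs_indicator_sub_twoScale_smoothSign_le {σlo σhi ε : ℝ} (hpos : 0 < σlo)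
    (hle : σlo ≤ σhi) (hε : 0 < ε) (x : ℝ) :
    |(if 0 < x then 1 else 0) - σhi / (σhi + σlo) -
      σlo / (σhi + σlo) * twoScale (σlo / σhi) (smoothSign ε) x| ≤
        if |x| ≤ (σlo / σhi)⁻¹ * ε then 1 else 0 := by
  have hσhi : 0 < σhi := hpos.trans_le hle
  have hθ : 0 < σlo / σhi := div_pos hpos hσhi
  have hθ1 : 1 ≤ (σlo / σhi)⁻¹ := (one_le_inv₀ hθ).2 ((div_le_one hσhi).2 hle)
  have hp : 0 < σlo / (σhi + σlo) := by positivity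
  have hp' : 0 < σhi / (σhi + σlo) := by positivity
  have hsum : σlo / (σhi + σlo) + σhi / (σhi + σlo) = 1 := by
    field_simp
    ring
  have hratio : σlo / (σhi + σlo) * (σlo / σhi)⁻¹ = σhi / (σhi + σlo) := by
    field_simp
  have hfar : ∀ z, ε ≤ z → smoothSign ε z = 1 := fun z hz => smoothSign_of_le hε hz
  rcases le_or_gt x 0 with hx | hx
  · have e : twoScale (σlo / σhi) (smoothSign ε) x =
        -((σlo / σhi)⁻¹ * smoothSign ε (σlo / σhi * -x)) := by
      rcases hx.eq_or_lt with rfl | hx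
      · simp [twoScale, smoothSign]
      · rw [twoScale, if_neg hx.not_ge, mul_neg, smoothSign_neg, mul_neg, neg_neg]
    have e2 : (if 0 < x then (1 : ℝ) else 0) - σhi / (σhi + σlo) -
        σlo / (σhi + σlo) * twoScale (σlo / σhi) (smoothSign ε) x =
        -(σhi / (σhi + σlo) * (1 - smoothSign ε (σlo / σhi * -x))) := by
      rw [if_neg hx.not_gt, e, ← hratio]
      ring
    have h0 : 0 ≤ smoothSign ε (σlo / σhi * -x) :=
      smoothSign_nonneg hε (mul_nonneg hθ.le (neg_nonneg.2 hx))
    have h1 := smoothSign_le_one ε (σlo / σhi * -x)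
    rw [e2, abs_neg, abs_of_nonneg (mul_nonneg hp'.le (by linarith)), abs_of_nonpos hx]
    split_ifs with h
    · nlinarith
    · rw [hfar _ (by
        rw [not_le, inv_mul_lt_iff₀ hθ] at h
        exact h.le)]
      simp
  · have e2 : (if 0 < x then (1 : ℝ) else 0) - σhi / (σhi + σlo) -
        σlo / (σhi + σlo) * twoScale (σlo / σhi) (smoothSign ε) x =
        σlo / (σhi + σlo) * (1 - smoothSign ε x) := by
      rw [if_pos hx, twoScale, if_pos hx.le]
      linarith
    have h0 : 0 ≤ smoothSign ε x := smoothSign_nonneg hε hx.le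
    have h1 := smoothSign_le_one ε x
    rw [e2, abs_of_nonneg (mul_nonneg hp.le (by linarith)), abs_of_pos hx]
    split_ifs with h
    · nlinarith
    · rw [hfar _ ((le_mul_of_one_le_left hε.le hθ1).trans (not_le.1 h).le)]
      simp

namespace Beliefs

variable {A : Type*} {Ω : Finset ℝ}

theorem measurable_gains (n : ℕ) : Measurable (gains (Ω := Ω) n) := by
  unfold gains
  fun_prop

theorem measureReal_gains_eq_integral (B : Beliefs A Ω) (s : Strategy A Ω) (n : ℕ)
    {S : Set ℝ} (hS : MeasurableSet S) [DecidablePred (· ∈ S)] :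
    (B.pathMeasure s).real {ω | gains n ω ∈ S} =
      ∫ ω, (if gains n ω ∈ S then 1 else 0) ∂(B.pathMeasure s) := by
  have hm : MeasurableSet {ω : ℕ → Ω | gains n ω ∈ S} := measurable_gains n hS
  rw [← integral_indicator_one hm]
  refine integral_congr_ae (Eventually.of_forall fun ω => ?_)
  simp [Set.indicator_apply]

/-- Under the switching strategy the probability of being in gains converges to the mass that the
oscillating Brownian motion with standard deviations `σhi` on losses and `σlo` on gains puts on the
positive half-line. -/
theorem tendsto_measureReal_gains_pos (B : Beliefs A Ω) (hnl : B.NoLearning)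
    (hmean : B.MeanZero) {σlo σhi : ℝ} (hpos : 0 < σlo) (hle : σlo ≤ σhi)
    (hlo : ∀ a, σlo ≤ B.sd a) (hhi : ∀ a, B.sd a ≤ σhi) {aHi aLo : A} (haHi : B.sd aHi = σhi)
    (haLo : B.sd aLo = σlo) :
    Tendsto (fun n : ℕ => (B.pathMeasure (switchingStrategy aHi aLo)).real {ω | 0 < gains n ω})
      atTop (𝓝 (σhi / (σhi + σlo))) := by
  have hσhi : 0 < σhi := hpos.trans_le hle
  have hθ : 0 < σlo / σhi := div_pos hpos hσhi
  set P := B.pathMeasure (switchingStrategy aHi aLo)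
  set p := σlo / (σhi + σlo) with hp
  refine Metric.tendsto_nhds.2 fun δ hδ => ?_
  obtain ⟨η, hη, hsmall⟩ := B.exists_eventually_measureReal_abs_gains_le hnl hmean hpos hle hlo hhi
    (switchingStrategy aHi aLo) (half_pos hδ)
  set ε := σlo / σhi * η with hεdef
  have hε : 0 < ε := by positivity
  have hlim := (B.tendsto_integral_twoScale_gains hnl hmean hpos hle hlo hhi haHi haLo
    (abs_smoothSign_sub_le hε) (smoothSign_neg ε)).const_mul p
  rw [mul_zero] at hlim
  filter_upwards [hsmall, Metric.tendsto_nhds.1 hlim _ (half_pos hδ), eventually_gt_atTop 0]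
    with n h1 h2 hn
  have hn' : (0 : ℝ) < √n := Real.sqrt_pos.2 (by exact_mod_cast hn)
  rw [Real.dist_eq, sub_zero] at h2
  have hint : ∀ f : ℝ → ℝ, Integrable (fun ω => f (gains n ω)) P := fun f =>
    B.integrable_comp_gains _ n f
  have e1 : P.real {ω | 0 < gains n ω} = ∫ ω, (if 0 < gains n ω / √n then 1 else 0) ∂P := by
    have := B.measureReal_gains_eq_integral (switchingStrategy aHi aLo) n
      (measurableSet_Ioi (a := (0 : ℝ)))
    simpa only [Set.mem_Ioi, div_pos_iff_of_pos_right hn'] using this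
  have e2 : P.real {ω | |gains n ω / √n| ≤ η} =
      ∫ ω, (if |gains n ω / √n| ≤ (σlo / σhi)⁻¹ * ε then 1 else 0) ∂P := by
    have hS : MeasurableSet {z : ℝ | |z / √n| ≤ η} :=
      measurableSet_le (by fun_prop) measurable_const
    have := B.measureReal_gains_eq_integral (switchingStrategy aHi aLo) n hS
    simpa only [Set.mem_ofPred_eq, hεdef, inv_mul_cancel_left₀ hθ.ne'] using this
  have i1 := hint fun z => if 0 < z / √n then 1 else 0
  have i2 := (hint fun z => twoScale (σlo / σhi) (smoothSign ε) (z / √n)).const_mul p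
  have hdiff : |P.real {ω | 0 < gains n ω} - σhi / (σhi + σlo) -
      p * ∫ ω, twoScale (σlo / σhi) (smoothSign ε) (gains n ω / √n) ∂P| ≤
      P.real {ω | |gains n ω / √n| ≤ η} := by
    rw [e1, e2, ← integral_const_mul]
    have hc : σhi / (σhi + σlo) = ∫ _, σhi / (σhi + σlo) ∂P := by simp
    conv_lhs => rw [hc]
    have i3 : Integrable (fun ω => (if 0 < gains n ω / √n then (1 : ℝ) else 0) -
        σhi / (σhi + σlo)) P := i1.sub (integrable_const _)
    rw [← integral_sub i1 (integrable_const _), ← integral_sub i3 i2]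
    refine abs_integral_le_integral_abs.trans ?_
    refine integral_mono (i3.sub i2).abs
      (hint fun z => if |z / √n| ≤ (σlo / σhi)⁻¹ * ε then 1 else 0) fun ω => ?_
    exact abs_indicator_sub_twoScale_smoothSign_le hpos hle hε _
  rw [Real.dist_eq]
  calc |P.real {ω | 0 < gains n ω} - σhi / (σhi + σlo)|
      ≤ |P.real {ω | 0 < gains n ω} - σhi / (σhi + σlo) -
          p * ∫ ω, twoScale (σlo / σhi) (smoothSign ε) (gains n ω / √n) ∂P| +
        |p * ∫ ω, twoScale (σlo / σhi) (smoothSign ε) (gains n ω / √n) ∂P| := by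
        simpa using abs_add_le (P.real {ω | 0 < gains n ω} - σhi / (σhi + σlo) -
          p * ∫ ω, twoScale (σlo / σhi) (smoothSign ε) (gains n ω / √n) ∂P)
          (p * ∫ ω, twoScale (σlo / σhi) (smoothSign ε) (gains n ω / √n) ∂P)
    _ < δ := by linarith

theorem measureReal_gains_nonpos (B : Beliefs A Ω) (s : Strategy A Ω) (n : ℕ) :
    (B.pathMeasure s).real {ω | gains n ω ≤ 0} =
      1 - (B.pathMeasure s).real {ω | 0 < gains n ω} := by
  have hm : MeasurableSet {ω : ℕ → Ω | 0 < gains n ω} :=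
    measurableSet_lt measurable_const (measurable_gains n)
  rw [← probReal_compl_eq_one_sub hm]
  congr 1
  ext ω
  simp

end Beliefs

/-! ### Gain utilities -/

theorem IsGainUtility.tendsto_add {φ₁ : ℝ → ℝ} (h : IsGainUtility φ₁) {z : ℝ} (hz : 0 ≤ z) :
    Tendsto (fun t => φ₁ (z + t)) (𝓝[>] 0) (𝓝 (φ₁ z)) := by
  have ht : Tendsto (fun t : ℝ => z + t) (𝓝[>] 0) (𝓝[Set.Ici 0] z) := by
    refine tendsto_nhdsWithin_iff.2 ⟨?_, ?_⟩
    · have : Continuous fun t : ℝ => z + t := by fun_prop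
      simpa using (this.tendsto 0).mono_left nhdsWithin_le_nhds
    · filter_upwards [self_mem_nhdsWithin] with t ht
      exact Set.mem_Ici.2 (add_nonneg hz (Set.mem_Ioi.1 ht).le)
  exact (h.contDiffOn.continuousOn z (Set.mem_Ici.2 hz)).tendsto.comp ht

theorem IsGainUtility.concaveOn {φ₁ : ℝ → ℝ} (h : IsGainUtility φ₁) :
    ConcaveOn ℝ (Set.Ici 0) φ₁ := by
  refine ⟨convex_Ici 0, fun x hx y hy a b ha hb hab => ?_⟩
  -- The inequality holds for `x + t` and `y + t` with `t > 0`; let `t` tend to `0`.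
  have hxy : a • x + b • y ∈ Set.Ici (0 : ℝ) := convex_Ici 0 hx hy ha hb hab
  refine le_of_tendsto_of_tendsto (((h.tendsto_add hx).const_smul a).add
    ((h.tendsto_add hy).const_smul b)) (h.tendsto_add hxy) ?_
  filter_upwards [self_mem_nhdsWithin] with t ht
  have hpos : ∀ z, z ∈ Set.Ici (0 : ℝ) → z + t ∈ Set.Ioi (0 : ℝ) := fun z hz =>
    Set.mem_Ioi.2 (add_pos_of_nonneg_of_pos hz ht)
  have := h.strictConcaveOn.concaveOn.2 (hpos x hx) (hpos y hy) ha hb hab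
  have e : a • (x + t) + b • (y + t) = a • x + b • y + t := by
    simp only [smul_eq_mul]
    linear_combination t * hab
  rwa [e] at this

theorem IsGainUtility.monotoneOn {φ₁ : ℝ → ℝ} (h : IsGainUtility φ₁) :
    MonotoneOn φ₁ (Set.Ici 0) := by
  intro x hx y hy hxy
  refine le_of_tendsto_of_tendsto (h.tendsto_add hx) (h.tendsto_add hy) ?_
  filter_upwards [self_mem_nhdsWithin] with t ht
  exact h.strictMonoOn.monotoneOn (Set.mem_Ioi.2 (add_pos_of_nonneg_of_pos hx ht))
    (Set.mem_Ioi.2 (add_pos_of_nonneg_of_pos hy ht)) (by linarith)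

/-- A gain utility is Lipschitz: its slopes are nonnegative by monotonicity and, by concavity, at
most the right derivative at `0`. -/
theorem IsGainUtility.exists_lipschitz {φ₁ : ℝ → ℝ} (h : IsGainUtility φ₁) :
    ∃ L : ℝ, ∀ x y, 0 ≤ x → 0 ≤ y → |φ₁ x - φ₁ y| ≤ L * |x - y| := by
  have hd : HasDerivWithinAt φ₁ (derivWithin φ₁ (Set.Ici 0) 0) (Set.Ici 0) 0 :=
    ((h.contDiffOn.differentiableOn (by norm_num)) 0 (by simp)).hasDerivWithinAt
  set L := derivWithin φ₁ (Set.Ici 0) 0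
  have h0 : ∀ y, 0 < y → (φ₁ y - φ₁ 0) / (y - 0) ≤ L := fun y hy => by
    have := h.concaveOn.slope_le_of_hasDerivWithinAt (Set.mem_Ici.2 le_rfl) (Set.mem_Ici.2 hy.le)
      hy hd
    rwa [slope_def_field] at this
  have hlt : ∀ x y, 0 ≤ x → x < y → |φ₁ y - φ₁ x| ≤ L * |y - x| := by
    intro x y hx hxy
    have hy : 0 ≤ y := hx.trans hxy.le
    rw [abs_of_nonneg (sub_nonneg.2 (h.monotoneOn hx hy hxy.le)), abs_of_pos (sub_pos.2 hxy),
      ← div_le_iff₀ (sub_pos.2 hxy)]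
    rcases hx.eq_or_lt with rfl | hx
    · exact h0 y hxy
    · exact (h.concaveOn.slope_anti_adjacent (Set.mem_Ici.2 le_rfl) hy hx hxy).trans (h0 x hx)
  refine ⟨L, fun x y hx hy => ?_⟩
  rcases lt_trichotomy x y with hxy | rfl | hxy
  · rw [abs_sub_comm, abs_sub_comm x]
    exact hlt x y hx hxy
  · simp
  · exact hlt y x hy hxy

/-- The odd extension of a gain utility: it is `φ₁ x` for `0 ≤ x` and `-φ₁ (-x)` for `x ≤ 0`. -/
noncomputable def oddExtension (φ₁ : ℝ → ℝ) (x : ℝ) : ℝ := φ₁ (max x 0) - φ₁ (max (-x) 0)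

theorem oddExtension_neg (φ₁ : ℝ → ℝ) (x : ℝ) : oddExtension φ₁ (-x) = -oddExtension φ₁ x := by
  rw [oddExtension, oddExtension, neg_neg, neg_sub]

namespace IsGainUtility

variable {φ₁ : ℝ → ℝ}

theorem oddExtension_of_nonneg (h : IsGainUtility φ₁) {x : ℝ} (hx : 0 ≤ x) :
    oddExtension φ₁ x = φ₁ x := by
  rw [oddExtension, max_eq_left hx, max_eq_right (neg_nonpos.2 hx), h.zero, sub_zero]

theorem concaveOn_oddExtension (h : IsGainUtility φ₁) :
    ConcaveOn ℝ (Set.Ici 0) (oddExtension φ₁) :=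
  h.concaveOn.congr fun _ hx => (h.oddExtension_of_nonneg hx).symm

theorem exists_lipschitz_oddExtension (h : IsGainUtility φ₁) :
    ∃ L : ℝ, ∀ x y, |oddExtension φ₁ x - oddExtension φ₁ y| ≤ L * |x - y| := by
  obtain ⟨L, hL⟩ := h.exists_lipschitz
  have hL0 : 0 ≤ L := by simpa using (abs_nonneg _).trans (hL 1 0 zero_le_one le_rfl)
  refine ⟨2 * L, fun x y => ?_⟩
  have e1 := (hL (max x 0) (max y 0) (le_max_right _ _) (le_max_right _ _)).trans
    (mul_le_mul_of_nonneg_left (abs_max_sub_max_le_abs x y 0) hL0)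
  have e2 := (hL (max (-x) 0) (max (-y) 0) (le_max_right _ _) (le_max_right _ _)).trans
    (mul_le_mul_of_nonneg_left (abs_max_sub_max_le_abs (-x) (-y) 0) hL0)
  rw [show |-x - -y| = |x - y| by rw [neg_sub_neg, abs_sub_comm]] at e2
  unfold oddExtension
  rw [abs_le] at *
  constructor <;> linarith

theorem utilityIndex_eq_twoScale (h : IsGainUtility φ₁) {θ : ℝ} (hθ : 0 < θ) :
    utilityIndex φ₁ θ 0 = twoScale θ (oddExtension φ₁) := by
  funext x
  unfold utilityIndex twoScale
  split_ifs with hx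
  · rw [sub_zero, h.oddExtension_of_nonneg hx]
  · have hx' : 0 ≤ -(θ * x) := neg_nonneg.2 (mul_nonpos_of_nonneg_of_nonpos hθ.le (not_le.1 hx).le)
    have := oddExtension_neg φ₁ (θ * x)
    rw [h.oddExtension_of_nonneg hx'] at this
    rw [sub_zero, neg_mul, this, mul_neg, neg_neg]

end IsGainUtility

end Bandit

theorem theorem2 {A : Type*} [Finite A] (Ω : Finset ℝ) (B : Bandit.Beliefs A Ω)
    (hsupp : B.FullSupport) (hmean : B.MeanZero) (hnl : B.NoLearning)
    (σhi σlo : ℝ) (hhi : IsGreatest (Set.range B.sd) σhi) (hlo : IsLeast (Set.range B.sd) σlo)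
    (hpos : 0 < σlo) (hlt : σlo < σhi)
    (aHi aLo : A) (haHi : B.sd aHi = σhi) (haLo : B.sd aLo = σlo) :
    -- (i) asymptotic optimality, for every utility index with reference point `0`
    (∀ φ₁ : ℝ → ℝ, Bandit.IsGainUtility φ₁ →
      B.IsAsymptoticallyOptimal (Bandit.utilityIndex φ₁ (σlo / σhi) 0)
        (Bandit.switchingStrategy aHi aLo)) ∧
    -- (ii) the probabilities of staying forever in losses, and forever in gains
    (∀ N : ℕ, 0 < N →
      (B.pathMeasure (Bandit.switchingStrategy aHi aLo)).real
          {ω | ∀ n, N ≤ n → Bandit.gains n ω ≤ 0} ≤ σhi / (σhi + σlo) ∧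
      (B.pathMeasure (Bandit.switchingStrategy aHi aLo)).real
          {ω | ∀ n, N ≤ n → 0 < Bandit.gains n ω} ≤ σhi / (σhi + σlo)) ∧
    σhi / (σhi + σlo) < 1 ∧
    -- (iii) the limiting ratio of the choice probabilities
    Tendsto (fun n : ℕ =>
        (B.pathMeasure (Bandit.switchingStrategy aHi aLo)).real
            {ω | B.sd (Bandit.action (Bandit.switchingStrategy aHi aLo) n ω) = σhi} /
          (B.pathMeasure (Bandit.switchingStrategy aHi aLo)).real
            {ω | B.sd (Bandit.action (Bandit.switchingStrategy aHi aLo) n ω) = σlo})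
      atTop (𝓝 (σlo / σhi)) ∧
    σlo / σhi < 1 := by
  have hσhi : 0 < σhi := hpos.trans hlt
  have hθ : 0 < σlo / σhi := div_pos hpos hσhi
  have hloA : ∀ a, σlo ≤ B.sd a := fun a => hlo.2 ⟨a, rfl⟩
  have hhiA : ∀ a, B.sd a ≤ σhi := fun a => hhi.2 ⟨a, rfl⟩
  have hgain := B.tendsto_measureReal_gains_pos hnl hmean hpos hlt.le hloA hhiA haHi haLo
  set s : Bandit.Strategy A Ω := Bandit.switchingStrategy aHi aLo with hs
  have hloss : Tendsto (fun n : ℕ => (B.pathMeasure s).real {ω | Bandit.gains n ω ≤ 0}) atTop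
      (𝓝 (σlo / (σhi + σlo))) := by
    have h := hgain.const_sub 1
    rw [show 1 - σhi / (σhi + σlo) = σlo / (σhi + σlo) by field_simp; ring] at h
    simpa only [B.measureReal_gains_nonpos s] using h
  refine ⟨fun φ₁ hφ => ?_, fun N _ => ⟨?_, ?_⟩, ?_, ?_, (div_lt_one hσhi).2 hlt⟩
  · obtain ⟨L, hL⟩ := hφ.exists_lipschitz_oddExtension
    have hodd := Bandit.oddExtension_neg φ₁
    have hU := B.tendsto_integral_twoScale_gains hnl hmean hpos hlt.le hloA hhiA haHi haLo hL hodd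
    rw [← hφ.utilityIndex_eq_twoScale hθ, ← hs] at hU
    refine ⟨0, Metric.tendsto_nhds.2 fun ε hε => ?_, hU⟩
    have hup := B.eventually_integral_twoScale_gains_le hnl hmean hpos hlt.le hloA hhiA haHi haLo
      hL hodd (half_pos hε)
    rw [← hφ.utilityIndex_eq_twoScale hθ] at hup
    filter_upwards [Metric.tendsto_nhds.1 hU ε hε, hup] with n h1 h2
    have : Nonempty (Bandit.Strategy A Ω) := ⟨s⟩
    have hle : B.value (Bandit.utilityIndex φ₁ (σlo / σhi) 0) n ≤ ε / 2 :=
      ciSup_le fun s' => h2 s' (Or.inl hφ.concaveOn_oddExtension)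
    have hge : B.utility (Bandit.utilityIndex φ₁ (σlo / σhi) 0) n s ≤
        B.value (Bandit.utilityIndex φ₁ (σlo / σhi) 0) n :=
      le_ciSup (B.bddAbove_utility _ n) s
    rw [Real.dist_eq, sub_zero, abs_lt] at h1 ⊢
    exact ⟨h1.1.trans_le hge, by linarith⟩
  · refine (ge_of_tendsto hloss ?_).trans (div_le_div_of_nonneg_right hlt.le (by positivity))
    filter_upwards [eventually_ge_atTop N] with n hn
    exact measureReal_mono fun ω hω => hω n hn
  · refine ge_of_tendsto hgain ?_
    filter_upwards [eventually_ge_atTop N] with n hn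
    exact measureReal_mono fun ω hω => hω n hn
  · rw [div_lt_one (by positivity)]
    linarith
  · have hquot := hloss.div hgain (by positivity)
    rw [show σlo / (σhi + σlo) / (σhi / (σhi + σlo)) = σlo / σhi by field_simp] at hquot
    refine hquot.congr fun n => ?_
    have e1 : {ω : ℕ → Ω | Bandit.gains n ω ≤ 0} = {ω | B.sd (Bandit.action s n ω) = σhi} := by
      ext ω
      simp only [Set.mem_ofPred_eq, hs, Bandit.action_switchingStrategy]
      split_ifs with h <;> simp [h, haHi, haLo, hlt.ne]
    have e2 : {ω : ℕ → Ω | 0 < Bandit.gains n ω} = {ω | B.sd (Bandit.action s n ω) = σlo} := by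
      ext ω
      simp only [Set.mem_ofPred_eq, hs, Bandit.action_switchingStrategy]
      split_ifs with h
      · simp [h, haHi, hlt.ne']
      · simp [not_le.1 h, haLo]
    rw [Pi.div_apply, e1, e2]
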